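/- Throughout, $P_k$ denotes the path with $k$ edges. A $2$-edge coloring of $K_{n,n}$ is a partition $E(K_{n,n})=R\sqcup B$ into red and blue edges; it contains a balanced copy of a finite graph $G$ if there is a copy of $G$ in $K_{n,n}$ whose numbers of red and of blue edges differ by at most one. Let $\mathrm{bbal}(n,G)$ be the smallest integer $m\ge 0$ such that every $2$-edge coloring $E(K_{n,n})=R\sqcup B$ with $\min\{|R|,|B|\}>m$ contains a balanced copy of $G$. Let $\mathrm{Bbal}(n,G)$ be the family of graphs $H$ (up to isomorphism and isolated vertices) with exactly $\mathrm{bbal}(n,G)$ edges, each occurring as a color class of a $2$-edge coloring of $K_{n,n}$ without a balanced copy of $G$, such that a $2$-edge coloring of $K_{n,n}$ with exactly $\mathrm{bbal}(n,G)$ edges in one color contains no balanced copy of $G$ if and only if the graph induced by its red edges or the graph induced by its blue edges is isomorphic to a member of $\mathrm{Bbal}(n,G)$. Theorem. Let $n\ge 2$ and $k\ge 2$ be integers, where $k$ is even, and put $s=\left\lfloor\frac{k-2}{4}\right\rfloor$. If $n>\frac{k-2}{2}\left(\frac{k}{2}-s\right)$, then $$\mathrm{bbal}(n,P_k)=\mathrm{bbal}(n,P_{k+1})=s\,n+0^{\alpha},$$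 where $\alpha\in\{0,2\}$ is such that $k\equiv\alpha\pmod 4$ (and $0^0=1$). Moreover, $\mathrm{Bbal}(n,P_k)=\mathrm{Bbal}(n,P_{k+1})=\{K_{s,n}\}$ if $k\equiv 2\pmod 4$, and $\mathrm{Bbal}(n,P_k)=\mathrm{Bbal}(n,P_{k+1})=\{H_{s,n}\}$ if $k\equiv 0\pmod 4$, where $H_{s,n}$ is the graph $K_{s,n}$ with one extra pendant vertex adjacent to a vertex of the partite set with $n$ vertices. -/

import Mathlib

namespace BipartiteBalancing

/-- The complete bipartite graph `K_{n,n}`. -/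
abbrev Knn (n : ℕ) : SimpleGraph (Fin n ⊕ Fin n) :=
  completeBipartiteGraph (Fin n) (Fin n)

/-- `E(K_{n,n}) = R ⊔ B` is a 2-edge colouring: the red graph `R` and the blue graph `B` (taken as
spanning subgraphs) have no common edge and together have exactly the edges of `K_{n,n}`. -/
def IsTwoColoring (n : ℕ) (R B : SimpleGraph (Fin n ⊕ Fin n)) : Prop :=
  Disjoint R B ∧ R ⊔ B = Knn n

/-- The number of edges of `G` which a map `f` of the vertices sends to edges of `R`. -/
noncomputable def colorCount {V : Type} {n : ℕ} (G : SimpleGraph V) (f : V → Fin n ⊕ Fin n)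
    (R : SimpleGraph (Fin n ⊕ Fin n)) : ℕ :=
  {e ∈ G.edgeSet | e.map f ∈ R.edgeSet}.ncard

/-- The 2-edge colouring `R ⊔ B` of `K_{n,n}` contains a balanced copy of the finite graph `G`: a
copy of `G` in `K_{n,n}` whose numbers of red and blue edges differ by at most one. -/
def HasBalancedCopy {V : Type} [Finite V] {n : ℕ} (G : SimpleGraph V)
    (R B : SimpleGraph (Fin n ⊕ Fin n)) : Prop :=
  ∃ f : G.Copy (Knn n), |(colorCount G f R : ℤ) - (colorCount G f B : ℤ)| ≤ 1

/-- Every 2-edge colouring of `K_{n,n}` with more than `m` edges in each colour class contains a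
balanced copy of `G`. -/
def ForcesBalanced {V : Type} [Finite V] (n : ℕ) (G : SimpleGraph V) (m : ℕ) : Prop :=
  ∀ R B : SimpleGraph (Fin n ⊕ Fin n), IsTwoColoring n R B →
    m < R.edgeSet.ncard → m < B.edgeSet.ncard → HasBalancedCopy G R B

/-- The set of which `bbal` is the least element is never empty. -/
theorem exists_forcesBalanced {V : Type} [Finite V] (n : ℕ) (G : SimpleGraph V) :
    {m : ℕ | ForcesBalanced n G m}.Nonempty := by
  refine ⟨(Knn n).edgeSet.ncard, fun R B hRB hR _ => absurd hR (not_lt.2 ?_)⟩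
  refine Set.ncard_le_ncard ?_ (Set.toFinite _)
  exact SimpleGraph.edgeSet_mono (hRB.2 ▸ le_sup_left)

/-- The bipartite balancing number `bbal(n, G)`: the smallest `m` such that every 2-edge colouring
of `K_{n,n}` with more than `m` edges in each colour contains a balanced copy of `G`. -/
noncomputable def bbal {V : Type} [Finite V] (n : ℕ) (G : SimpleGraph V) : ℕ :=
  sInf {m : ℕ | ForcesBalanced n G m}

/-- The graphs induced by the edge sets of `G` and of `H` are isomorphic, that is, `G` and `H` are
isomorphic after the isolated vertices of both are deleted. -/
def EdgeIso {V W : Type} (G : SimpleGraph V) (H : SimpleGraph W) : Prop :=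
  Nonempty (G.induce G.support ≃g H.induce H.support)

/-- `F` is (up to isomorphism) the family `Bbal(n, G)` of extremal colour graphs:
its members have exactly `bbal(n, G)` edges; a 2-edge colouring of `K_{n,n}` with exactly
`bbal(n, G)` edges in one colour has no balanced copy of `G` if and only if its red graph or its
blue graph is isomorphic to a member of `F`; and every member of `F` does occur in this way, so
that `F` has no superfluous members. -/
structure IsBbal {V : Type} [Finite V] (n : ℕ) (G : SimpleGraph V)
    (F : Set (Σ W : Type, SimpleGraph W)) : Prop where
  edges : ∀ H ∈ F, H.2.edgeSet.encard = (bbal n G : ℕ∞)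
  extremal : ∀ R B : SimpleGraph (Fin n ⊕ Fin n), IsTwoColoring n R B →
    (R.edgeSet.ncard = bbal n G ∨ B.edgeSet.ncard = bbal n G) →
    (¬ HasBalancedCopy G R B ↔ ∃ H ∈ F, EdgeIso R H.2 ∨ EdgeIso B H.2)
  occurs : ∀ H ∈ F, ∃ R B : SimpleGraph (Fin n ⊕ Fin n), IsTwoColoring n R B ∧
    ¬ HasBalancedCopy G R B ∧ EdgeIso R H.2

/-- The path `P_k` with `k` edges (and `k + 1` vertices). -/
abbrev P (k : ℕ) : SimpleGraph (Fin (k + 1)) := SimpleGraph.pathGraph (k + 1)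

/-- `H_{s,n}`: the complete bipartite graph `K_{s,n}` (on the vertices `inl (some i)` and `inr j`)
with one extra pendant vertex `inl none`, adjacent only to the first vertex of the partite set with
`n` vertices. -/
def pendantKsn (s n : ℕ) : SimpleGraph (Option (Fin s) ⊕ Fin n) :=
  SimpleGraph.fromRel fun x y =>
    match x, y with
    | Sum.inl (some _), Sum.inr _ => True
    | Sum.inl none, Sum.inr j => j.val = 0
    | _, _ => False

end BipartiteBalancing

/-!
# Balanced paths in two-coloured complete bipartite graphs

Write `t = k / 2` and `s = ⌊(t - 1) / 2⌋`, so that `t = 2s + 1` or `t = 2s + 2`; put `d = 0` or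
`d = 1` accordingly. A balanced copy of `P_{2t}` or of `P_{2t+1}` has at least `t` edges of each
colour.

*Interpolation.* The cycles `C` of length `2t + 2` in `K_{n,n}` carry both kinds of paths, so it is
enough to study their numbers `ρ(C)` of red edges. Deleting a vertex of `C` leaves a `P_{2t}`, and
an averaging argument shows that one of these has exactly `t` red edges whenever
`t ≤ ρ(C) ≤ t + 2` (`exists_window_sum_eq`); the same stretch, longer by one edge, is a balanced
`P_{2t+1}`. Cycles are given by orderings of the two sides, and exchanging two consecutive places in
such an ordering replaces at most two edges of the cycle (`abs_cyclicSum_swap_sub_le`). These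
exchanges generate all permutations, so `ρ` cannot skip the three values `t, t + 1, t + 2`
(`exists_cycleCount_mem`). Hence there is a balanced path as soon as one cycle has at least `t` red
edges and another one at least `t` blue edges (`IsTwoColoring.hasBalancedCopy`).

*Extremal problem in one colour.* Suppose no cycle of length `2t + 2` has `t` or more edges in the
bipartite graph `r`. There is no matching with `t` edges, so by König's theorem some cover has at most `t - 1`
vertices. If fewer than `s` of them have degree at least `t`, then `r` has at most
`(s - 1) n + (t - s)(t - 1) < s n` edges, which is where the lower bound on `n` comes from.
Otherwise choose `s` vertices of degree at least `t`. If `d + 1` edges avoid all of them, these edges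
and two private neighbours for each of the `s` vertices form a linear forest with `t` edges, which
fits on a cycle of length `2t + 2` (`exists_cycleCount_ge`). So at most `d` edges avoid the `s`
vertices, and `r` has at most `s n + d` edges, with equality only for `s` full stars on one side and
`d` further edges (`relCard_le_of_no_cycle`).

*Conversely,* a path meets each of `s` vertices in at most two edges, so it has at most
`2s + d < t` edges in such a graph (`colorCount_le_of_edgeIso`). Everything about `K_{s,n}` and
`H_{s,n}` which the argument uses is collected in `IsStarModel`.
-/

namespace BipartiteBalancing
open Finset

/-! ### Interpolation between cycles -/

/-- The indicator of `r a b`, as an integer. -/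
noncomputable def ind {α β : Type} (r : α → β → Prop) (a : α) (b : β) : ℤ :=
  open Classical in if r a b then 1 else 0

theorem ind_nonneg {α β : Type} (r : α → β → Prop) (a : α) (b : β) : 0 ≤ ind r a b := by
  unfold ind; split_ifs <;> norm_num

theorem ind_le_one {α β : Type} (r : α → β → Prop) (a : α) (b : β) : ind r a b ≤ 1 := by
  unfold ind; split_ifs <;> norm_num

theorem ind_of {α β : Type} {r : α → β → Prop} {a : α} {b : β} (h : r a b) : ind r a b = 1 :=
  if_pos h

/-- A pair of permutations `σ`, `τ` of the two sides of `K_{n,n}` places the cycle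
`σ 0, τ 0, σ 1, τ 1, …, σ t, τ t` of length `2t + 2`; this is the number of its edges which lie in
the relation `r`. -/
noncomputable def cycleCount {n t : ℕ} (h : t + 1 ≤ n) (r : Fin n → Fin n → Prop)
    (σ τ : Equiv.Perm (Fin n)) : ℤ :=
  ∑ i : Fin (t + 1), (ind r (σ (i.castLE h)) (τ (i.castLE h)) +
    ind r (σ ((i + 1).castLE h)) (τ (i.castLE h)))

theorem abs_sum_sub_le_two {ι : Type} [Fintype ι] [DecidableEq ι] (g g' : ι → ℤ) (l l' : ι)
    (h0 : ∀ i, |g' i - g i| ≤ 1) (h : ∀ i, i ≠ l → i ≠ l' → g' i = g i) :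
    |∑ i, g' i - ∑ i, g i| ≤ 2 := by
  rw [← Finset.sum_sub_distrib]
  calc |∑ i, (g' i - g i)| ≤ ∑ i, |g' i - g i| := Finset.abs_sum_le_sum_abs _ _
    _ ≤ ∑ i, ((if i = l then 1 else 0) + (if i = l' then 1 else 0)) := by
      refine Finset.sum_le_sum fun i _ => ?_
      have := h0 i
      split_ifs with h1 h2 h2
      · linarith
      · simpa using h0 i
      · simpa using h0 i
      · simp [h i h1 h2]
    _ = 2 := by simp [Finset.sum_add_distrib]

theorem val_add_one_eq {t : ℕ} (i : Fin (t + 1)) :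
    (i.val = t ∧ (i + 1).val = 0) ∨ (i.val < t ∧ (i + 1).val = i.val + 1) := by
  rcases eq_or_ne i (Fin.last t) with rfl | hi
  · left; simp
  · right
    have := Fin.val_lt_last hi
    exact ⟨this, Fin.val_add_one_of_lt' (by omega)⟩

/-- Let `σ` order the vertices of one side, and let `F i a` say whether `a` is joined to the `i`-th
vertex of the other side. Exchanging two consecutive positions on one side of the cycle alters at
most two edges: the vertex between the two positions, if there is one, keeps both of its
neighbours. -/
theorem abs_cyclicSum_swap_sub_le {n t : ℕ} (ht : 0 < t) (h : t + 1 ≤ n + 1)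
    (F : Fin (t + 1) → Fin (n + 1) → ℤ)
    (h0 : ∀ i a, 0 ≤ F i a) (h1 : ∀ i a, F i a ≤ 1) (σ : Equiv.Perm (Fin (n + 1))) (p : Fin n) :
    |∑ i, (F i ((σ * Equiv.swap p.castSucc p.succ) (i.castLE h)) +
        F i ((σ * Equiv.swap p.castSucc p.succ) ((i + 1).castLE h))) -
      ∑ i, (F i (σ (i.castLE h)) + F i (σ ((i + 1).castLE h)))| ≤ 2 := by
  have key : ∀ x : Fin (t + 1),
      (x.val = p.val ∧ (σ * Equiv.swap p.castSucc p.succ) (x.castLE h) = σ p.succ ∧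
        σ (x.castLE h) = σ p.castSucc) ∨
      (x.val = p.val + 1 ∧ (σ * Equiv.swap p.castSucc p.succ) (x.castLE h) = σ p.castSucc ∧
        σ (x.castLE h) = σ p.succ) ∨
      (x.val ≠ p.val ∧ x.val ≠ p.val + 1 ∧
        (σ * Equiv.swap p.castSucc p.succ) (x.castLE h) = σ (x.castLE h)) := by
    intro x
    by_cases hx : x.val = p.val
    · have : x.castLE h = p.castSucc := by simpa [Fin.ext_iff] using hx
      exact Or.inl ⟨hx, by rw [Equiv.Perm.mul_apply, this, Equiv.swap_apply_left], by rw [this]⟩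
    by_cases hx' : x.val = p.val + 1
    · have : x.castLE h = p.succ := by simpa [Fin.ext_iff] using hx'
      exact Or.inr (Or.inl
        ⟨hx', by rw [Equiv.Perm.mul_apply, this, Equiv.swap_apply_right], by rw [this]⟩)
    · refine Or.inr (Or.inr ⟨hx, hx', ?_⟩)
      rw [Equiv.Perm.mul_apply, Equiv.swap_apply_of_ne_of_ne]
      · simpa [Fin.ext_iff] using hx
      · simpa [Fin.ext_iff] using hx'
  -- `l` is the term before position `p`, and `l'` the one after position `p + 1` (or, if `p` is the
  -- last position of the cycle, the other term at `p`).
  obtain ⟨l, hl⟩ : ∃ l : Fin (t + 1), ∀ i, i ≠ l → (i + 1).val ≠ p.val := by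
    by_cases hp : p.val ≤ t
    · refine ⟨⟨p.val, by omega⟩ - 1, fun i hi h' => hi ?_⟩
      rw [eq_sub_iff_add_eq]
      exact Fin.ext h'
    · exact ⟨0, fun i _ => by have := (i + 1).isLt; omega⟩
  obtain ⟨l', hl'⟩ : ∃ l' : Fin (t + 1), ∀ i, i ≠ l' →
      (p.val < t → i.val ≠ p.val + 1) ∧ (p.val = t → i.val ≠ t) := by
    rcases lt_trichotomy p.val t with hp | hp | hp
    · refine ⟨⟨p.val + 1, by omega⟩, fun i hi => ⟨fun _ h' => hi (Fin.ext h'), by omega⟩⟩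
    · exact ⟨Fin.last t, fun i hi => ⟨by omega, fun _ h' => hi (Fin.ext h')⟩⟩
    · exact ⟨0, fun i _ => ⟨by omega, by omega⟩⟩
  refine abs_sum_sub_le_two _ _ l l' (fun i => ?_) fun i hi hi' => ?_
  · have hs := val_add_one_eq i
    have a0 := h0 i
    have a1 := h1 i
    rcases key i with ⟨b, b1, b2⟩ | ⟨b, b1, b2⟩ | ⟨b, b', b1⟩ <;>
    rcases key (i + 1) with ⟨c, c1, c2⟩ | ⟨c, c1, c2⟩ | ⟨c, c', c1⟩ <;>
    first
    | omega
    | (rw [b1, c1, abs_le]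
       try rw [b2]
       try rw [c2]
       constructor <;> linarith [a0 (σ p.succ), a0 (σ p.castSucc), a1 (σ p.succ),
        a1 (σ p.castSucc)])
  · have hs := val_add_one_eq i
    have b0 := hl i hi
    have b0' := hl' i hi'
    rcases key i with ⟨b, b1, b2⟩ | ⟨b, b1, b2⟩ | ⟨b, b', b1⟩ <;>
    rcases key (i + 1) with ⟨c, c1, c2⟩ | ⟨c, c1, c2⟩ | ⟨c, c', c1⟩ <;>
    first
    | omega
    | (rw [b1, c1]
       try rw [b2]
       try rw [c2]
       try ring)

theorem cycleCount_eq_sum_right {n t : ℕ} (h : t + 1 ≤ n) (r : Fin n → Fin n → Prop)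
    (σ τ : Equiv.Perm (Fin n)) :
    cycleCount h r σ τ = ∑ i : Fin (t + 1), (ind r (σ ((i + 1).castLE h)) (τ (i.castLE h)) +
      ind r (σ ((i + 1).castLE h)) (τ ((i + 1).castLE h))) := by
  unfold cycleCount
  rw [Finset.sum_add_distrib, Finset.sum_add_distrib, add_comm]
  congr 1
  exact (Equiv.sum_comp (Equiv.addRight (1 : Fin (t + 1)))
    (fun i => ind r (σ (i.castLE h)) (τ (i.castLE h)))).symm

/-- A property of permutations which is kept by exchanging two consecutive positions, and which
holds for one permutation, holds for all of them. -/
theorem perm_induction_adjacent {n : ℕ} {Q : Equiv.Perm (Fin (n + 1)) → Prop}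
    (hQ : ∀ σ (p : Fin n), Q σ → Q (σ * Equiv.swap p.castSucc p.succ))
    {σ₀ : Equiv.Perm (Fin (n + 1))} (h₀ : Q σ₀) (σ : Equiv.Perm (Fin (n + 1))) : Q σ := by
  have key : ∀ π ∈ Submonoid.closure (Set.range fun i : Fin n => Equiv.swap i.castSucc i.succ),
      ∀ ρ, Q ρ → Q (ρ * π) := by
    intro π hπ
    induction hπ using Submonoid.closure_induction with
    | mem x hx =>
      obtain ⟨p, rfl⟩ := hx
      exact fun ρ hρ => hQ ρ p hρ
    | one => exact fun ρ hρ => by simpa using hρ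
    | mul x y _ _ hx hy =>
        intro ρ hρ
        rw [← mul_assoc]
        exact hy _ (hx _ hρ)
  have := key (σ₀⁻¹ * σ) (by rw [Equiv.Perm.mclosure_swap_castSucc_succ]; trivial) σ₀ h₀
  simpa using this

/-- Any two placements of the cycle are joined by steps which alter the count by at most two, so
the count cannot jump over three consecutive values. -/
theorem exists_cycleCount_mem {n t : ℕ} (ht : 0 < t) (h : t + 1 ≤ n) (r : Fin n → Fin n → Prop)
    (u : ℤ) (hlow : ∃ σ τ, cycleCount h r σ τ ≤ u + 2) (hhigh : ∃ σ τ, u ≤ cycleCount h r σ τ) :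
    ∃ σ τ, u ≤ cycleCount h r σ τ ∧ cycleCount h r σ τ ≤ u + 2 := by
  obtain ⟨n, rfl⟩ : ∃ m, n = m + 1 := ⟨n - 1, by omega⟩
  by_contra hcon
  push Not at hcon
  obtain ⟨σ₀, τ₀, h₀⟩ := hlow
  obtain ⟨σ₁, τ₁, h₁⟩ := hhigh
  have hτ : ∀ τ, cycleCount h r σ₀ τ < u := by
    refine fun τ => perm_induction_adjacent (Q := fun τ => cycleCount h r σ₀ τ < u)
      (fun τ p hp => ?_) (σ₀ := τ₀) ?_ τ
    · have := abs_le.1 (abs_cyclicSum_swap_sub_le ht h (fun i b => ind r (σ₀ ((i + 1).castLE h)) b)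
        (fun _ _ => ind_nonneg _ _ _) (fun _ _ => ind_le_one _ _ _) τ p)
      rw [← cycleCount_eq_sum_right, ← cycleCount_eq_sum_right] at this
      by_contra hge
      have := hcon _ _ (not_lt.1 hge)
      omega
    · by_contra hge
      have := hcon _ _ (not_lt.1 hge)
      omega
  have hσ : ∀ σ, cycleCount h r σ τ₁ < u := by
    refine fun σ => perm_induction_adjacent (Q := fun σ => cycleCount h r σ τ₁ < u)
      (fun σ p hp => ?_) (hτ τ₁) σ
    have := abs_le.1 (abs_cyclicSum_swap_sub_le ht h (fun i a => ind r a (τ₁ (i.castLE h)))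
      (fun _ _ => ind_nonneg _ _ _) (fun _ _ => ind_le_one _ _ _) σ p)
    change -2 ≤ cycleCount h r _ τ₁ - cycleCount h r σ τ₁ ∧
      cycleCount h r _ τ₁ - cycleCount h r σ τ₁ ≤ 2 at this
    by_contra hge
    have := hcon _ _ (not_lt.1 hge)
    omega
  exact absurd (hσ σ₁) (not_lt.2 h₁)

/-- In a cyclic 0-1 word of length `2t + 2` with `t`, `t + 1` or `t + 2` ones some `2t` consecutive
letters contain exactly `t` ones. -/
theorem exists_window_sum_eq {t : ℕ} (h : ℕ → ℤ) (h0 : ∀ j, 0 ≤ h j) (h1 : ∀ j, h j ≤ 1)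
    (hper : ∀ j, h (j + (2 * t + 2)) = h j) (hlow : (t : ℤ) ≤ ∑ j ∈ range (2 * t + 2), h j)
    (hhigh : ∑ j ∈ range (2 * t + 2), h j ≤ t + 2) :
    ∃ q, ∑ j ∈ range (2 * t), h (q + j) = t := by
  set ρ := ∑ j ∈ range (2 * t + 2), h j with hρ
  have hshift : ∀ q, ∑ j ∈ range (2 * t + 2), h (q + j) = ρ := by
    intro q
    induction q with
    | zero => simp [hρ]
    | succ q ih =>
      have e1 := Finset.sum_range_succ (fun j => h (q + j)) (2 * t + 2)
      have e2 := Finset.sum_range_succ' (fun j => h (q + j)) (2 * t + 2)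
      have e3 : ∑ j ∈ range (2 * t + 2), h (q + 1 + j) =
          ∑ j ∈ range (2 * t + 2), h (q + (j + 1)) :=
        Finset.sum_congr rfl fun j _ => by rw [add_assoc, add_comm 1 j]
      have e4 := hper q
      simp only [add_zero] at e2
      linarith
  have hpair : ∑ q ∈ range (2 * t + 2), (h q + h (q + 1)) = 2 * ρ := by
    have := hshift 1
    rw [Finset.sum_add_distrib, ← hρ]
    simp only [add_comm _ 1] at this ⊢
    linarith
  by_contra hcon
  push Not at hcon
  -- a window misses two consecutive letters, so no such pair sums to `ρ - t`
  have hne : ∀ q, h q + h (q + 1) ≠ ρ - t := by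
    intro q hq
    refine hcon (q + 2) ?_
    have e := hshift (q + 2)
    rw [Finset.sum_range_succ, Finset.sum_range_succ] at e
    have e1 := hper q
    have e2 := hper (q + 1)
    rw [show q + (2 * t + 2) = q + 2 + 2 * t by ring] at e1
    rw [show q + 1 + (2 * t + 2) = q + 2 + (2 * t + 1) by ring] at e2
    linarith
  obtain e | e | e : ρ = t ∨ ρ = t + 1 ∨ ρ = t + 2 := by omega
  · have : ∑ q ∈ range (2 * t + 2), (1 : ℤ) ≤ ∑ q ∈ range (2 * t + 2), (h q + h (q + 1)) :=
      Finset.sum_le_sum fun q _ => by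
        have := hne q; have := h0 q; have := h0 (q + 1); omega
    rw [hpair] at this
    simp at this
    omega
  · have hc : ∀ q, h q = h 0 := by
      intro q
      induction q with
      | zero => rfl
      | succ q ih =>
        have := hne q; have := h0 q; have := h0 (q + 1); have := h1 q; have := h1 (q + 1)
        omega
    have : ρ = (2 * t + 2) * h 0 := by
      rw [hρ, Finset.sum_congr rfl fun q _ => hc q]
      simp
    have a0 := h0 0
    have a1 := h1 0
    obtain b | b : h 0 = 0 ∨ h 0 = 1 := by omega
    all_goals rw [b] at this; omega
  · have : ∑ q ∈ range (2 * t + 2), (h q + h (q + 1)) ≤ ∑ q ∈ range (2 * t + 2), (1 : ℤ) :=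
      Finset.sum_le_sum fun q _ => by
        have := hne q; have := h1 q; have := h1 (q + 1); omega
    rw [hpair] at this
    simp at this
    omega

/-! ### Paths along a cycle -/

/-- The adjacency of `R` between the two sides of `K_{n,n}`, as a relation on `Fin n`. -/
def biRel {n : ℕ} (R : SimpleGraph (Fin n ⊕ Fin n)) (a b : Fin n) : Prop :=
  R.Adj (Sum.inl a) (Sum.inr b)

theorem ind_adj_comm {V : Type} (R : SimpleGraph V) (x y : V) : ind R.Adj x y = ind R.Adj y x := by
  classical
  exact if_congr (R.adj_comm x y) rfl rfl

theorem pathEdge_injective (k : ℕ) :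
    Function.Injective fun i : Fin k => s(i.castSucc, i.succ) := by
  intro i j hij
  simp only [Sym2.eq_iff, Fin.ext_iff, Fin.val_castSucc, Fin.val_succ] at hij
  exact Fin.ext (by omega)

open Classical in
theorem colorCount_P {n k : ℕ} (f : Fin (k + 1) → Fin n ⊕ Fin n)
    (R : SimpleGraph (Fin n ⊕ Fin n)) :
    colorCount (P k) f R = #{i : Fin k | R.Adj (f i.castSucc) (f i.succ)} := by
  unfold colorCount
  rw [← Set.ncard_coe_finset, ← Set.ncard_image_of_injective _ (pathEdge_injective k)]
  congr 1
  ext e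
  constructor
  · induction e with
    | _ u v =>
      rintro ⟨he, hR⟩
      rw [SimpleGraph.mem_edgeSet, SimpleGraph.pathGraph_adj] at he
      rw [Sym2.map_mk, SimpleGraph.mem_edgeSet] at hR
      rcases he with he | he
      · have hu : u.val < k := by omega
        have e1 : u = (⟨u.val, hu⟩ : Fin k).castSucc := rfl
        have e2 : v = (⟨u.val, hu⟩ : Fin k).succ := Fin.ext he.symm
        refine ⟨⟨u.val, hu⟩, ?_, ?_⟩
        · simpa [← e1, ← e2] using hR
        · simp only [← e1, ← e2]
      · have hv : v.val < k := by omega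
        have e1 : v = (⟨v.val, hv⟩ : Fin k).castSucc := rfl
        have e2 : u = (⟨v.val, hv⟩ : Fin k).succ := Fin.ext he.symm
        refine ⟨⟨v.val, hv⟩, ?_, ?_⟩
        · simpa [← e1, ← e2] using hR.symm
        · simp only [← e1, ← e2, Sym2.eq_swap]
  · rintro ⟨i, hi, rfl⟩
    refine ⟨?_, ?_⟩
    · rw [SimpleGraph.mem_edgeSet, SimpleGraph.pathGraph_adj]
      left; simp
    · simpa using hi

/-- The vertex at position `j` of the cycle `σ 0, τ 0, σ 1, τ 1, …, σ t, τ t`, repeated with period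
`2t + 2`. -/
def cycleVertex {n t : ℕ} (h : t + 1 ≤ n) (σ τ : Equiv.Perm (Fin n)) (j : ℕ) : Fin n ⊕ Fin n :=
  if j % 2 = 0 then Sum.inl (σ ((Fin.ofNat (t + 1) (j / 2)).castLE h))
  else Sum.inr (τ ((Fin.ofNat (t + 1) (j / 2)).castLE h))

theorem cycleVertex_even {n t : ℕ} (h : t + 1 ≤ n) (σ τ : Equiv.Perm (Fin n)) (i : ℕ) :
    cycleVertex h σ τ (2 * i) = Sum.inl (σ ((Fin.ofNat (t + 1) i).castLE h)) := by
  simp [cycleVertex]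

theorem cycleVertex_odd {n t : ℕ} (h : t + 1 ≤ n) (σ τ : Equiv.Perm (Fin n)) (i : ℕ) :
    cycleVertex h σ τ (2 * i + 1) = Sum.inr (τ ((Fin.ofNat (t + 1) i).castLE h)) := by
  have h1 : (2 * i + 1) % 2 = 1 := by omega
  have h2 : (2 * i + 1) / 2 = i := by omega
  simp [cycleVertex, h1, h2]

theorem cycleVertex_add_period {n t : ℕ} (h : t + 1 ≤ n) (σ τ : Equiv.Perm (Fin n)) (j : ℕ) :
    cycleVertex h σ τ (j + (2 * t + 2)) = cycleVertex h σ τ j := by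
  have h1 : (j + (2 * t + 2)) % 2 = j % 2 := by omega
  have h2 : (j + (2 * t + 2)) / 2 = j / 2 + (t + 1) := by omega
  have h3 : Fin.ofNat (t + 1) (j / 2 + (t + 1)) = Fin.ofNat (t + 1) (j / 2) := by
    apply Fin.ext; simp [Fin.ofNat]
  simp only [cycleVertex, h1, h2, h3]

theorem modEq_of_cycleVertex_eq {n t : ℕ} (h : t + 1 ≤ n) (σ τ : Equiv.Perm (Fin n)) {i j : ℕ}
    (hij : cycleVertex h σ τ i = cycleVertex h σ τ j) : i ≡ j [MOD 2 * t + 2] := by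
  have main : i % 2 = j % 2 ∧ (i / 2) % (t + 1) = (j / 2) % (t + 1) := by
    unfold cycleVertex at hij
    split_ifs at hij with h1 h2 h2
    · have := Fin.castLE_injective h (σ.injective (Sum.inl.inj hij))
      exact ⟨by omega, congrArg Fin.val this⟩
    · have := Fin.castLE_injective h (τ.injective (Sum.inr.inj hij))
      exact ⟨by omega, congrArg Fin.val this⟩
  have key : ∀ x, x % (2 * t + 2) = x % 2 + 2 * (x / 2 % (t + 1)) := fun x => by
    rw [show 2 * t + 2 = 2 * (t + 1) by ring, Nat.mod_mul]
  rw [Nat.ModEq, key, key, main.1, main.2]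

theorem cycleVertex_adj {n t : ℕ} (h : t + 1 ≤ n) (σ τ : Equiv.Perm (Fin n)) (j : ℕ) :
    (Knn n).Adj (cycleVertex h σ τ j) (cycleVertex h σ τ (j + 1)) := by
  unfold cycleVertex
  split_ifs with h1 h2 h2
  · omega
  · simp
  · simp
  · omega

theorem sum_range_two_mul {M : Type} [AddCommMonoid M] (g : ℕ → M) (m : ℕ) :
    ∑ j ∈ range (2 * m), g j = ∑ i ∈ range m, (g (2 * i) + g (2 * i + 1)) := by
  induction m with
  | zero => simp
  | succ m ih =>
    rw [Finset.sum_range_succ, ← ih, show 2 * (m + 1) = 2 * m + 1 + 1 by ring,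
      Finset.sum_range_succ, Finset.sum_range_succ, add_assoc]

theorem sum_cycleVertex {n t : ℕ} (h : t + 1 ≤ n) (σ τ : Equiv.Perm (Fin n))
    (R : SimpleGraph (Fin n ⊕ Fin n)) :
    ∑ j ∈ range (2 * t + 2), ind R.Adj (cycleVertex h σ τ j) (cycleVertex h σ τ (j + 1)) =
      cycleCount h (biRel R) σ τ := by
  rw [show 2 * t + 2 = 2 * (t + 1) by ring, sum_range_two_mul, cycleCount, Finset.sum_range]
  refine Finset.sum_congr rfl fun i _ => ?_
  rw [show 2 * i.val + 1 + 1 = 2 * (i.val + 1) by ring, cycleVertex_even, cycleVertex_odd,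
    cycleVertex_even]
  have e1 : Fin.ofNat (t + 1) i.val = i := Fin.ofNat_val_eq_self i
  have e2 : Fin.ofNat (t + 1) (i.val + 1) = i + 1 := by
    apply Fin.ext
    simp [Fin.ofNat, Fin.val_add]
  rw [e1, e2, ind_adj_comm R (Sum.inr _)]
  rfl

/-- The copy of a path which runs along the cycle from position `q`. -/
def cyclePath {n t k : ℕ} (h : t + 1 ≤ n) (hk : k < 2 * t + 2) (σ τ : Equiv.Perm (Fin n)) (q : ℕ) :
    (P k).Copy (Knn n) where
  toHom :=
    { toFun := fun j => cycleVertex h σ τ (q + j.val)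
      map_rel' := by
        intro i j hij
        rcases SimpleGraph.pathGraph_adj.1 hij with e | e
        · have := cycleVertex_adj h σ τ (q + i.val)
          rwa [add_assoc, e] at this
        · have := (cycleVertex_adj h σ τ (q + j.val)).symm
          rwa [add_assoc, e] at this }
  injective' := by
    intro i j hij
    have := Nat.ModEq.add_left_cancel' q (modEq_of_cycleVertex_eq h σ τ hij)
    exact Fin.ext (this.eq_of_lt_of_lt (by omega) (by omega))

theorem colorCount_cyclePath {n t k : ℕ} (h : t + 1 ≤ n) (hk : k < 2 * t + 2)
    (σ τ : Equiv.Perm (Fin n)) (q : ℕ) (R : SimpleGraph (Fin n ⊕ Fin n)) :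
    (colorCount (P k) (cyclePath h hk σ τ q) R : ℤ) = ∑ j ∈ range k,
      ind R.Adj (cycleVertex h σ τ (q + j)) (cycleVertex h σ τ (q + j + 1)) := by
  classical
  rw [colorCount_P, Finset.card_filter, Finset.sum_range]
  push_cast
  refine Finset.sum_congr rfl fun i _ => ?_
  unfold ind
  congr 1

theorem IsTwoColoring.symm {n : ℕ} {R B : SimpleGraph (Fin n ⊕ Fin n)} (h : IsTwoColoring n R B) :
    IsTwoColoring n B R :=
  ⟨h.1.symm, by rw [sup_comm]; exact h.2⟩

theorem HasBalancedCopy.symm {V : Type} [Finite V] {n : ℕ} {G : SimpleGraph V}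
    {R B : SimpleGraph (Fin n ⊕ Fin n)} (h : HasBalancedCopy G R B) : HasBalancedCopy G B R := by
  obtain ⟨f, hf⟩ := h
  exact ⟨f, by rwa [abs_sub_comm]⟩

theorem IsTwoColoring.adj_or {n : ℕ} {R B : SimpleGraph (Fin n ⊕ Fin n)}
    (h : IsTwoColoring n R B) {x y} (hxy : (Knn n).Adj x y) : R.Adj x y ∨ B.Adj x y := by
  rwa [← h.2, SimpleGraph.sup_adj] at hxy

theorem IsTwoColoring.not_adj {n : ℕ} {R B : SimpleGraph (Fin n ⊕ Fin n)}
    (h : IsTwoColoring n R B) {x y} (hR : R.Adj x y) : ¬ B.Adj x y := fun hB =>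
  (SimpleGraph.disjoint_left.1 h.1 x y hR) hB

theorem IsTwoColoring.ind_add_ind {n : ℕ} {R B : SimpleGraph (Fin n ⊕ Fin n)}
    (h : IsTwoColoring n R B) {x y} (hxy : (Knn n).Adj x y) : ind R.Adj x y + ind B.Adj x y = 1 := by
  unfold ind
  rcases h.adj_or hxy with hR | hB
  · simp [hR, h.not_adj hR]
  · simp [hB, h.symm.not_adj hB]

theorem IsTwoColoring.cycleCount_add {n t : ℕ} {R B : SimpleGraph (Fin n ⊕ Fin n)}
    (hRB : IsTwoColoring n R B) (h : t + 1 ≤ n) (σ τ : Equiv.Perm (Fin n)) :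
    cycleCount h (biRel R) σ τ + cycleCount h (biRel B) σ τ = 2 * t + 2 := by
  rw [← sum_cycleVertex, ← sum_cycleVertex, ← Finset.sum_add_distrib,
    Finset.sum_congr rfl fun j _ => hRB.ind_add_ind (cycleVertex_adj h σ τ j)]
  simp

theorem IsTwoColoring.colorCount_add {n k : ℕ} {R B : SimpleGraph (Fin n ⊕ Fin n)}
    (hRB : IsTwoColoring n R B) (f : (P k).Copy (Knn n)) :
    colorCount (P k) f R + colorCount (P k) f B = k := by
  classical
  rw [colorCount_P, colorCount_P, ← Finset.card_union_of_disjoint, ← Finset.filter_or,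
    Finset.filter_true_of_mem, Finset.card_univ, Fintype.card_fin]
  · intro i _
    refine hRB.adj_or (f.toHom.map_adj ?_)
    rw [SimpleGraph.pathGraph_adj]
    left; simp
  · rw [Finset.disjoint_filter]
    exact fun i _ hR => hRB.not_adj hR

/-- If some cycle of length `2t + 2` has at least `t` red edges and some has at least `t` blue
edges, then there are balanced paths with `2t` and with `2t + 1` edges. -/
theorem IsTwoColoring.hasBalancedCopy {n t k : ℕ} {R B : SimpleGraph (Fin n ⊕ Fin n)}
    (hRB : IsTwoColoring n R B) (ht : 0 < t) (h : t + 1 ≤ n) (hk : k = 2 * t ∨ k = 2 * t + 1)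
    (hR : ∃ σ τ, (t : ℤ) ≤ cycleCount h (biRel R) σ τ)
    (hB : ∃ σ τ, (t : ℤ) ≤ cycleCount h (biRel B) σ τ) : HasBalancedCopy (P k) R B := by
  have hB' : ∃ σ τ, cycleCount h (biRel R) σ τ ≤ t + 2 := by
    obtain ⟨σ, τ, hστ⟩ := hB
    exact ⟨σ, τ, by have := hRB.cycleCount_add h σ τ; omega⟩
  obtain ⟨σ, τ, h1, h2⟩ := exists_cycleCount_mem ht h (biRel R) t hB' hR
  rw [← sum_cycleVertex] at h1 h2
  obtain ⟨q, hq⟩ := exists_window_sum_eq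
    (fun j => ind R.Adj (cycleVertex h σ τ j) (cycleVertex h σ τ (j + 1)))
    (fun _ => ind_nonneg _ _ _) (fun _ => ind_le_one _ _ _)
    (fun j => by
      have e := cycleVertex_add_period h σ τ (j + 1)
      rw [show j + 1 + (2 * t + 2) = j + (2 * t + 2) + 1 by ring] at e
      rw [cycleVertex_add_period, e]) h1 h2
  have hlt : k < 2 * t + 2 := by omega
  refine ⟨cyclePath h hlt σ τ q, ?_⟩
  have hadd := hRB.colorCount_add (cyclePath h hlt σ τ q)
  have hcount := colorCount_cyclePath h hlt σ τ q R
  rcases hk with rfl | rfl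
  · rw [hq] at hcount
    rw [abs_le]
    omega
  · rw [Finset.sum_range_succ, hq] at hcount
    have i0 := ind_nonneg R.Adj (cycleVertex h σ τ (q + 2 * t)) (cycleVertex h σ τ (q + 2 * t + 1))
    have i1 := ind_le_one R.Adj (cycleVertex h σ τ (q + 2 * t)) (cycleVertex h σ τ (q + 2 * t + 1))
    rw [abs_le]
    omega

/-! ### Packing stars and edges on a cycle -/

theorem exists_perm_extending {n : ℕ} {D : Type} [Finite D] (pos val : D → Fin n)
    (hpos : Function.Injective pos) (hval : Function.Injective val) :
    ∃ σ : Equiv.Perm (Fin n), ∀ d, σ (pos d) = val d := by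
  classical
  let e : Set.range pos ≃ Set.range val :=
    (Equiv.ofInjective pos hpos).symm.trans (Equiv.ofInjective val hval)
  refine ⟨Equiv.extendSubtype (p := (· ∈ Set.range pos)) (q := (· ∈ Set.range val)) e,
    fun d => ?_⟩
  rw [Equiv.extendSubtype_apply_of_mem _ _ ⟨d, rfl⟩]
  change ((Equiv.ofInjective val hval) ((Equiv.ofInjective pos hpos).symm
    (Equiv.ofInjective pos hpos d)) : Fin n) = val d
  rw [Equiv.symm_apply_apply]
  rfl

open Classical in
/-- Vertices of high degree have two private neighbours each, outside a given small set. -/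
theorem exists_private_neighbours {n p : ℕ} (N : Fin p → Finset (Fin n)) (F : Finset (Fin n))
    (hN : ∀ j, 2 * p + #F ≤ #(N j)) :
    ∃ u : Fin p × Fin 2 → Fin n, Function.Injective u ∧ ∀ d, u d ∈ N d.1 ∧ u d ∉ F := by
  obtain ⟨u, hu, hu'⟩ := (Finset.all_card_le_biUnion_card_iff_exists_injective
    (fun d : Fin p × Fin 2 => N d.1 \ F)).1 (by
      intro Z
      rcases Z.eq_empty_or_nonempty with rfl | ⟨d, hd⟩
      · simp
      · calc #Z ≤ Fintype.card (Fin p × Fin 2) := Finset.card_le_univ Z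
          _ = 2 * p := by simp [mul_comm]
          _ ≤ #(N d.1 \ F) := by
            have := Finset.le_card_sdiff F (N d.1)
            have := hN d.1
            omega
          _ ≤ _ := Finset.card_le_card
            (Finset.subset_biUnion_of_mem (fun d : Fin p × Fin 2 => N d.1 \ F) hd))
  exact ⟨u, hu, fun d => Finset.mem_sdiff.1 (hu' d)⟩

theorem sum_range_le_cycleCount {n t : ℕ} (h : t + 1 ≤ n) (r : Fin n → Fin n → Prop)
    (σ τ : Equiv.Perm (Fin n)) (a b : ℕ → Fin n) (ha : ∀ i (hi : i < n), a i = σ ⟨i, hi⟩)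
    (hb : ∀ i (hi : i < n), b i = τ ⟨i, hi⟩) :
    ∑ i ∈ range t, (ind r (a i) (b i) + ind r (a (i + 1)) (b i)) ≤ cycleCount h r σ τ := by
  rw [cycleCount, Fin.sum_univ_castSucc, Finset.sum_range]
  refine le_add_of_le_of_nonneg (le_of_eq (Finset.sum_congr rfl fun i _ => ?_))
    (add_nonneg (ind_nonneg _ _ _) (ind_nonneg _ _ _))
  rw [ha i (by omega), ha (i + 1) (by omega), hb i (by omega)]
  have : (i.castSucc + 1).castLE h = ⟨i.val + 1, by omega⟩ := by
    apply Fin.ext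
    simp
  rw [this]
  rfl

open Classical in
/-- Vertices of high degree, each with two private neighbours, and a further piece `x 0, y 0, x 1,
y 1, …` avoiding them, are placed together on one cycle. A star with centre `α j` takes the
positions `2 j` and `2 j + 1` (its centre on the later one), a star with centre `β j` the positions
`2 p + 2 j` and `2 p + 2 j + 1` (its centre on the earlier one). -/
theorem exists_cycleCount_ge {n p q m t : ℕ} (ht : t = 2 * p + 2 * q + m) (h : t + 1 ≤ n)
    (r : Fin n → Fin n → Prop) (α : Fin p → Fin n) (β : Fin q → Fin n) (x y : Fin m → Fin n)
    (hα : Function.Injective α) (hβ : Function.Injective β) (hx : Function.Injective x)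
    (hy : Function.Injective y) (hαx : ∀ i j, α i ≠ x j) (hβy : ∀ i j, β i ≠ y j)
    (hdα : ∀ j, 2 * p + q + m ≤ #{b | r (α j) b}) (hdβ : ∀ j, 2 * q + p + m ≤ #{a | r a (β j)})
    (hxy : (m : ℤ) ≤ ∑ i : Fin m, (ind r (x i) (y i) +
      if hi : i.val + 1 < m then ind r (x ⟨i.val + 1, hi⟩) (y i) else 0)) :
    ∃ σ τ, (t : ℤ) ≤ cycleCount h r σ τ := by
  have hn : 0 < n := by omega
  have cimg : ∀ {k : ℕ} (f : Fin k → Fin n), #(univ.image f) ≤ k := fun f =>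
    Finset.card_image_le.trans (by simp)
  obtain ⟨u, hu, hu'⟩ := exists_private_neighbours (fun j => {b | r (α j) b})
    (univ.image β ∪ univ.image y) (fun j => by
      have := hdα j
      have := Finset.card_union_le (univ.image β) (univ.image y)
      have := cimg β
      have := cimg y
      omega)
  obtain ⟨v, hv, hv'⟩ := exists_private_neighbours (fun j => {a | r a (β j)})
    (univ.image α ∪ univ.image x) (fun j => by
      have := hdβ j
      have := Finset.card_union_le (univ.image α) (univ.image x)
      have := cimg α
      have := cimg x
      omega)
  simp only [Finset.mem_filter, Finset.mem_univ, true_and, Finset.mem_union, Finset.mem_image,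
    not_or, not_exists] at hu' hv'
  obtain ⟨σ, hσ⟩ := exists_perm_extending (D := Fin p ⊕ (Fin q × Fin 2) ⊕ Fin m) (n := n)
    (Sum.elim (fun j => ⟨2 * j.val + 1, by omega⟩)
      (Sum.elim (fun d => ⟨2 * p + (2 * d.1.val + d.2.val), by omega⟩)
        (fun i => ⟨2 * p + 2 * q + i.val, by omega⟩)))
    (Sum.elim α (Sum.elim v x))
    (by
      rintro (i | ⟨i, e⟩ | i) (j | ⟨j, e'⟩ | j) hij <;>
        simp only [Sum.elim_inl, Sum.elim_inr, Fin.mk.injEq] at hij <;>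
        first
        | (exfalso; omega)
        | (simp only [Sum.inl.injEq, Sum.inr.injEq, Prod.mk.injEq, Fin.ext_iff]; omega))
    (by
      rintro (i | d | i) (j | d' | j) hij <;> simp only [Sum.elim_inl, Sum.elim_inr] at hij
      · rw [hα hij]
      · exact absurd hij ((hv' d').2.1 i)
      · exact absurd hij (hαx i j)
      · exact absurd hij.symm ((hv' d).2.1 j)
      · rw [hv hij]
      · exact absurd hij.symm ((hv' d).2.2 j)
      · exact absurd hij.symm (hαx j i)
      · exact absurd hij ((hv' d').2.2 i)
      · rw [hx hij])
  obtain ⟨τ, hτ⟩ := exists_perm_extending (D := Fin q ⊕ (Fin p × Fin 2) ⊕ Fin m) (n := n)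
    (Sum.elim (fun j => ⟨2 * p + 2 * j.val, by omega⟩)
      (Sum.elim (fun d => ⟨2 * d.1.val + d.2.val, by omega⟩)
        (fun i => ⟨2 * p + 2 * q + i.val, by omega⟩)))
    (Sum.elim β (Sum.elim u y))
    (by
      rintro (i | ⟨i, e⟩ | i) (j | ⟨j, e'⟩ | j) hij <;>
        simp only [Sum.elim_inl, Sum.elim_inr, Fin.mk.injEq] at hij <;>
        first
        | (exfalso; omega)
        | (simp only [Sum.inl.injEq, Sum.inr.injEq, Prod.mk.injEq, Fin.ext_iff]; omega))
    (by
      rintro (i | d | i) (j | d' | j) hij <;> simp only [Sum.elim_inl, Sum.elim_inr] at hij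
      · rw [hβ hij]
      · exact absurd hij ((hu' d').2.1 i)
      · exact absurd hij (hβy i j)
      · exact absurd hij.symm ((hu' d).2.1 j)
      · rw [hu hij]
      · exact absurd hij.symm ((hu' d).2.2 j)
      · exact absurd hij.symm (hβy j i)
      · exact absurd hij ((hu' d').2.2 i)
      · rw [hy hij])
  refine ⟨σ, τ, ?_⟩
  let a : ℕ → Fin n := fun i => if hi : i < n then σ ⟨i, hi⟩ else ⟨0, hn⟩
  let b : ℕ → Fin n := fun i => if hi : i < n then τ ⟨i, hi⟩ else ⟨0, hn⟩
  have ha : ∀ i (hi : i < n), a i = σ ⟨i, hi⟩ := fun i hi => dif_pos hi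
  have hb : ∀ i (hi : i < n), b i = τ ⟨i, hi⟩ := fun i hi => dif_pos hi
  refine le_trans ?_ (sum_range_le_cycleCount h r σ τ a b ha hb)
  have aα : ∀ j : Fin p, a (2 * j.val + 1) = α j := fun j => by
    rw [ha _ (by omega)]; exact hσ (Sum.inl j)
  have av : ∀ (j : Fin q) (e : Fin 2), a (2 * p + (2 * j.val + e.val)) = v (j, e) := fun j e => by
    rw [ha _ (by omega)]; exact hσ (Sum.inr (Sum.inl (j, e)))
  have ax : ∀ i : Fin m, a (2 * p + 2 * q + i.val) = x i := fun i => by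
    rw [ha _ (by omega)]; exact hσ (Sum.inr (Sum.inr i))
  have bβ : ∀ j : Fin q, b (2 * p + 2 * j.val) = β j := fun j => by
    rw [hb _ (by omega)]; exact hτ (Sum.inl j)
  have bu : ∀ (j : Fin p) (e : Fin 2), b (2 * j.val + e.val) = u (j, e) := fun j e => by
    rw [hb _ (by omega)]; exact hτ (Sum.inr (Sum.inl (j, e)))
  have yb : ∀ i : Fin m, b (2 * p + 2 * q + i.val) = y i := fun i => by
    rw [hb _ (by omega)]; exact hτ (Sum.inr (Sum.inr i))
  have nn := ind_nonneg r
  set g : ℕ → ℤ := fun i => ind r (a i) (b i) + ind r (a (i + 1)) (b i) with hg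
  have B1 : (2 * p : ℤ) ≤ ∑ i ∈ range (2 * p), g i := by
    rw [sum_range_two_mul, Finset.sum_range]
    calc (2 * p : ℤ) = ∑ j : Fin p, (2 : ℤ) := by simp [mul_comm]
      _ ≤ _ := Finset.sum_le_sum fun j _ => by
        have e1 : ind r (a (2 * j.val + 1)) (b (2 * j.val)) = 1 := ind_of (by
          have := bu j 0
          simp only [Fin.val_zero, add_zero] at this
          rw [aα, this]; exact (hu' (j, 0)).1)
        have e2 : ind r (a (2 * j.val + 1)) (b (2 * j.val + 1)) = 1 := ind_of (by
          have := bu j 1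
          simp only [Fin.val_one] at this
          rw [aα, this]; exact (hu' (j, 1)).1)
        have := nn (a (2 * j.val)) (b (2 * j.val))
        have := nn (a (2 * j.val + 1 + 1)) (b (2 * j.val + 1))
        simp only [hg]
        omega
  have B2 : (2 * q : ℤ) ≤ ∑ i ∈ range (2 * q), g (2 * p + i) := by
    rw [sum_range_two_mul, Finset.sum_range]
    calc (2 * q : ℤ) = ∑ j : Fin q, (2 : ℤ) := by simp [mul_comm]
      _ ≤ _ := Finset.sum_le_sum fun j _ => by
        have e1 : ind r (a (2 * p + 2 * j.val)) (b (2 * p + 2 * j.val)) = 1 := ind_of (by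
          have := av j 0
          simp only [Fin.val_zero, add_zero] at this
          rw [bβ, this]; exact (hv' (j, 0)).1)
        have e2 : ind r (a (2 * p + 2 * j.val + 1)) (b (2 * p + 2 * j.val)) = 1 := ind_of (by
          have := av j 1
          simp only [Fin.val_one, ← add_assoc] at this
          rw [bβ, this]; exact (hv' (j, 1)).1)
        have := nn (a (2 * p + (2 * j.val + 1))) (b (2 * p + (2 * j.val + 1)))
        have := nn (a (2 * p + (2 * j.val + 1) + 1)) (b (2 * p + (2 * j.val + 1)))
        simp only [hg]
        omega
  have B3 : (m : ℤ) ≤ ∑ i ∈ range m, g (2 * p + 2 * q + i) := by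
    rw [Finset.sum_range]
    refine hxy.trans (Finset.sum_le_sum fun i _ => ?_)
    simp only [hg]
    rw [ax, yb]
    have := nn (a (2 * p + 2 * q + i.val + 1)) (y i)
    split_ifs with hi
    · have := ax ⟨i.val + 1, hi⟩
      simp only [← add_assoc] at this
      rw [this]
    · omega
  rw [ht, Finset.sum_range_add, Finset.sum_range_add]
  push_cast
  linarith

/-! ### König's theorem -/

/-- In a smallest vertex cover every set of vertices of one side has enough neighbours outside the
cover, as otherwise its neighbours could replace it. -/
theorem exists_injective_of_minimal_cover {α β : Type} [Fintype β] [DecidableEq α] [DecidableEq β]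
    (r : α → β → Prop) (X : Finset α) (Y : Finset β) (hcov : ∀ a b, r a b → a ∈ X ∨ b ∈ Y)
    (hmin : ∀ X' Y', (∀ a b, r a b → a ∈ X' ∨ b ∈ Y') → #X + #Y ≤ #X' + #Y') :
    ∃ φ : X → β, Function.Injective φ ∧ ∀ a, r a.1 (φ a) ∧ φ a ∉ Y := by
  classical
  obtain ⟨φ, hφ, hφ'⟩ := (Finset.all_card_le_biUnion_card_iff_exists_injective
    (fun a : X => (univ : Finset β).filter fun b => r a.1 b ∧ b ∉ Y)).1 (by
      intro Z
      set T := Z.biUnion fun a : X => (univ : Finset β).filter fun b => r a.1 b ∧ b ∉ Y with hT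
      have hZX : Z.map (Function.Embedding.subtype _) ⊆ X := by
        intro a ha
        obtain ⟨a', _, rfl⟩ := Finset.mem_map.1 ha
        exact a'.2
      have := hmin (X \ Z.map (Function.Embedding.subtype _)) (Y ∪ T) (fun a b hab => by
        by_cases hb : b ∈ Y
        · exact Or.inr (Finset.mem_union_left _ hb)
        have ha := (hcov a b hab).resolve_right hb
        by_cases haZ : (⟨a, ha⟩ : X) ∈ Z
        · refine Or.inr (Finset.mem_union_right _ (Finset.mem_biUnion.2 ⟨_, haZ, ?_⟩))
          simp [hab, hb]
        · refine Or.inl (Finset.mem_sdiff.2 ⟨ha, fun h => haZ ?_⟩)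
          obtain ⟨a', h1, rfl⟩ := Finset.mem_map.1 h
          exact h1)
      rw [Finset.card_sdiff_of_subset hZX, Finset.card_map] at this
      have := Finset.card_union_le Y T
      have := Finset.card_le_card hZX
      rw [Finset.card_map] at this
      omega)
  exact ⟨φ, hφ, fun a => (Finset.mem_filter.1 (hφ' a)).2⟩

/-- König's theorem: there is a matching with `t` edges, or a vertex cover with fewer than `t`
vertices. -/
theorem exists_matching_or_cover {n : ℕ} (r : Fin n → Fin n → Prop) (t : ℕ) :
    (∃ x y : Fin t → Fin n, Function.Injective x ∧ Function.Injective y ∧ ∀ i, r (x i) (y i)) ∨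
    ∃ X Y : Finset (Fin n), #X + #Y < t ∧ ∀ a b, r a b → a ∈ X ∨ b ∈ Y := by
  classical
  obtain ⟨⟨X, Y⟩, hmem, hmin⟩ := Finset.exists_min_image
    ((univ : Finset (Finset (Fin n) × Finset (Fin n))).filter
      fun C => ∀ a b, r a b → a ∈ C.1 ∨ b ∈ C.2) (fun C => #C.1 + #C.2)
    ⟨(univ, univ), by simp⟩
  have hcov : ∀ a b, r a b → a ∈ X ∨ b ∈ Y := (Finset.mem_filter.1 hmem).2
  have hmin' : ∀ X' Y', (∀ a b, r a b → a ∈ X' ∨ b ∈ Y') → #X + #Y ≤ #X' + #Y' :=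
    fun X' Y' h => hmin (X', Y') (by simpa using h)
  by_cases hlt : #X + #Y < t
  · exact Or.inr ⟨X, Y, hlt, hcov⟩
  left
  obtain ⟨φ, hφ, hφ'⟩ := exists_injective_of_minimal_cover r X Y hcov hmin'
  obtain ⟨ψ, hψ, hψ'⟩ := exists_injective_of_minimal_cover (fun b a => r a b) Y X
    (fun b a h => (hcov a b h).symm)
    (fun Y' X' h => by
      have := hmin' X' Y' fun a b hab => (h b a hab).symm
      omega)
  have hcard : Fintype.card (Fin t) ≤ Fintype.card (X ⊕ Y) := by simp; omega
  obtain ⟨e⟩ := Function.Embedding.nonempty_of_card_le hcard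
  refine ⟨fun i => Sum.elim Subtype.val ψ (e i), fun i => Sum.elim φ Subtype.val (e i),
    Function.Injective.comp ?_ e.injective, Function.Injective.comp ?_ e.injective, fun i => ?_⟩
  · refine Function.Injective.sumElim Subtype.val_injective hψ fun a b hab => ?_
    exact (hψ' b).2 (hab ▸ a.2)
  · refine Function.Injective.sumElim hφ Subtype.val_injective fun a b hab => ?_
    exact (hφ' a).2 (hab ▸ b.2)
  · change r (Sum.elim Subtype.val ψ (e i)) (Sum.elim φ Subtype.val (e i))
    rcases e i with a | b
    · exact (hφ' a).1
    · exact (hψ' b).1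

/-! ### The extremal problem for one colour -/

open Classical in
/-- The number of edges of the bipartite graph given by the relation `r`. -/
noncomputable def relCard {n : ℕ} (r : Fin n → Fin n → Prop) : ℕ :=
  #{ab : Fin n × Fin n | r ab.1 ab.2}

/-- The bipartite graph `r` consists of all edges at `s` vertices of the first side together with
`d` further edges. -/
def IsStarUnion {n : ℕ} (r : Fin n → Fin n → Prop) (s d : ℕ) : Prop :=
  ∃ (A : Finset (Fin n)) (O : Finset (Fin n × Fin n)), #A = s ∧ #O = d ∧ (∀ ab ∈ O, ab.1 ∉ A) ∧
    ∀ a b, r a b ↔ a ∈ A ∨ (a, b) ∈ O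

open Classical in
/-- The degree of a vertex of either side in the bipartite graph `r`. -/
noncomputable def relDegree {n : ℕ} (r : Fin n → Fin n → Prop) : Fin n ⊕ Fin n → ℕ :=
  Sum.elim (fun a => #{b | r a b}) (fun b => #{a | r a b})

theorem relDegree_le {n : ℕ} (r : Fin n → Fin n → Prop) (c : Fin n ⊕ Fin n) :
    relDegree r c ≤ n := by
  unfold relDegree
  rcases c with a | b <;> simp only [Sum.elim_inl, Sum.elim_inr] <;>
    exact (Finset.card_le_univ (α := Fin n) _).trans_eq (Fintype.card_fin n)

theorem relCard_le_sum_relDegree {n : ℕ} (r : Fin n → Fin n → Prop) (X Y : Finset (Fin n))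
    (hcov : ∀ a b, r a b → a ∈ X ∨ b ∈ Y) :
    relCard r ≤ ∑ c ∈ X.disjSum Y, relDegree r c := by
  classical
  rw [Finset.sum_disjSum]
  have : ({ab : Fin n × Fin n | r ab.1 ab.2} : Finset _) ⊆
      (X.biUnion fun a => ({b | r a b} : Finset (Fin n)).image fun b => (a, b)) ∪
      (Y.biUnion fun b => ({a | r a b} : Finset (Fin n)).image fun a => (a, b)) := by
    rintro ⟨a, b⟩ hab
    have hr : r a b := (Finset.mem_filter.1 hab).2
    rcases hcov a b hr with h | h
    · refine Finset.mem_union_left _ (Finset.mem_biUnion.2 ⟨a, h, ?_⟩)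
      simpa using hr
    · refine Finset.mem_union_right _ (Finset.mem_biUnion.2 ⟨b, h, ?_⟩)
      simpa using hr
  unfold relCard
  refine (Finset.card_le_card this).trans ((Finset.card_union_le _ _).trans (add_le_add ?_ ?_))
  · exact Finset.card_biUnion_le.trans (Finset.sum_le_sum fun a _ => Finset.card_image_le)
  · exact Finset.card_biUnion_le.trans (Finset.sum_le_sum fun b _ => Finset.card_image_le)

/-- If a vertex cover with fewer than `t` vertices has fewer than `s` vertices of degree at least
`t`, then the graph has fewer than `s * n` edges. -/
theorem relCard_lt_of_few_high {n s t : ℕ} (r : Fin n → Fin n → Prop) (hst : s < t)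
    (hn : (t - 1) * (t - s) < n) (htn : t ≤ n) (C : Finset (Fin n ⊕ Fin n)) (hC : #C < t)
    (hcov : relCard r ≤ ∑ c ∈ C, relDegree r c) (hhigh : #{c ∈ C | t ≤ relDegree r c} < s) :
    relCard r < s * n := by
  classical
  rw [← Finset.sum_filter_add_sum_filter_not C (fun c => t ≤ relDegree r c)] at hcov
  have hcard := Finset.card_filter_add_card_filter_not (s := C) (fun c => t ≤ relDegree r c)
  have h1 : ∑ c ∈ C with t ≤ relDegree r c, relDegree r c ≤ _ :=
    Finset.sum_le_card_nsmul _ _ n fun c _ => relDegree_le r c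
  have h2 : ∑ c ∈ C with ¬ t ≤ relDegree r c, relDegree r c ≤ _ :=
    Finset.sum_le_card_nsmul _ _ (t - 1)
    fun c hc => by
      have := (Finset.mem_filter.1 hc).2
      omega
  rw [smul_eq_mul] at h1 h2
  set η := #(C.filter fun c => t ≤ relDegree r c)
  set ζ := #(C.filter fun c => ¬ t ≤ relDegree r c)
  obtain ⟨d, rfl⟩ : ∃ d, s = η + 1 + d := ⟨s - η - 1, by omega⟩
  have h3 : ζ * (t - 1) ≤ (t - 1) * (t - (η + 1 + d)) + d * (t - 1) := by
    rw [mul_comm (t - 1), ← add_mul]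
    exact Nat.mul_le_mul_right _ (by omega)
  have h4 : d * (t - 1) ≤ d * n := Nat.mul_le_mul_left _ (by omega)
  have h5 : (η + 1 + d) * n = η * n + n + d * n := by ring
  omega

theorem exists_not_mem_ne {n : ℕ} (A : Finset (Fin n)) (a : Fin n) (hA : #A + 1 < n) :
    ∃ c, c ∉ A ∧ c ≠ a := by
  classical
  obtain ⟨c, hc⟩ : ∃ c, c ∉ insert a A := by
    by_contra hcon
    push Not at hcon
    have := Finset.card_le_card (fun x _ => hcon x : (univ : Finset (Fin n)) ⊆ _)
    have h1 := Finset.card_insert_le a A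
    simp at this
    omega
  rw [Finset.mem_insert, not_or] at hc
  exact ⟨c, hc.2, hc.1⟩

/-- One edge, or two edges in any relative position, lie on a path `x 0, y 0, x 1, y 1` (or
`x 0, y 0`) of `K_{n,n}`. -/
theorem exists_zigzag {n m : ℕ} (r : Fin n → Fin n → Prop) (hm : m = 1 ∨ m = 2)
    (A B : Finset (Fin n)) (hA : #A + 1 < n) (hB : #B + 1 < n) (O : Finset (Fin n × Fin n))
    (hO : ∀ ab ∈ O, r ab.1 ab.2 ∧ ab.1 ∉ A ∧ ab.2 ∉ B) (hOm : m ≤ #O) :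
    ∃ x y : Fin m → Fin n, Function.Injective x ∧ Function.Injective y ∧ (∀ i, x i ∉ A) ∧
      (∀ i, y i ∉ B) ∧ (m : ℤ) ≤ ∑ i : Fin m, (ind r (x i) (y i) +
        if hi : i.val + 1 < m then ind r (x ⟨i.val + 1, hi⟩) (y i) else 0) := by
  have inj2 : ∀ {a b : Fin n}, a ≠ b → Function.Injective ![a, b] := fun {a b} h i j hij => by
    fin_cases i <;> fin_cases j <;> simp_all
  rcases hm with rfl | rfl
  · obtain ⟨⟨a, b⟩, hab⟩ := Finset.card_pos.1 (show 0 < #O by omega)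
    obtain ⟨h1, h2, h3⟩ := hO _ hab
    refine ⟨fun _ => a, fun _ => b, fun _ _ _ => Subsingleton.elim _ _,
      fun _ _ _ => Subsingleton.elim _ _, fun _ => h2, fun _ => h3, ?_⟩
    simp [ind_of h1]
  · obtain ⟨⟨a, b⟩, hab, ⟨a', b'⟩, hab', hne⟩ := Finset.one_lt_card.1 (show 1 < #O by omega)
    obtain ⟨h1, h2, h3⟩ := hO _ hab
    obtain ⟨h1', h2', h3'⟩ := hO _ hab'
    simp only at h1 h2 h3 h1' h2' h3'
    by_cases ha : a = a'
    · subst ha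
      have hb : b ≠ b' := fun h => hne (by rw [h])
      obtain ⟨c, hc, hca⟩ := exists_not_mem_ne A a hA
      refine ⟨![c, a], ![b, b'], inj2 hca, inj2 hb, ?_, ?_, ?_⟩
      · intro i; fin_cases i <;> simpa
      · intro i; fin_cases i <;> simpa
      · have := ind_nonneg r c b
        simp [Fin.sum_univ_two, ind_of h1, ind_of h1']
        omega
    by_cases hb : b = b'
    · subst hb
      obtain ⟨c, hc, hcb⟩ := exists_not_mem_ne B b hB
      refine ⟨![a, a'], ![b, c], inj2 ha, inj2 hcb.symm, ?_, ?_, ?_⟩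
      · intro i; fin_cases i <;> simpa
      · intro i; fin_cases i <;> simpa
      · have := ind_nonneg r a' c
        simp [Fin.sum_univ_two, ind_of h1, ind_of h1']
        omega
    · refine ⟨![a, a'], ![b, b'], inj2 ha, inj2 hb, ?_, ?_, ?_⟩
      · intro i; fin_cases i <;> simpa
      · intro i; fin_cases i <;> simpa
      · have := ind_nonneg r a' b
        simp [Fin.sum_univ_two, ind_of h1, ind_of h1']
        omega

open Classical in
/-- A bipartite graph in which all but at most `d` edges meet `A` or `B`. Edges between `A` and `B`
would be counted twice in `s * n`, so equality needs one of the two sets to be empty. -/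
theorem relCard_le_of_cover {n s d : ℕ} (r : Fin n → Fin n → Prop) (A B : Finset (Fin n))
    (hs : #A + #B = s)
    (hO : #{ab : Fin n × Fin n | r ab.1 ab.2 ∧ ab.1 ∉ A ∧ ab.2 ∉ B} ≤ d) :
    relCard r ≤ s * n + d ∧
      (relCard r = s * n + d → IsStarUnion r s d ∨ IsStarUnion (fun b a => r a b) s d) := by
  set O : Finset (Fin n × Fin n) := {ab | r ab.1 ab.2 ∧ ab.1 ∉ A ∧ ab.2 ∉ B} with hOdef
  set J : Finset (Fin n × Fin n) := {ab | r ab.1 ab.2 ∧ (ab.1 ∈ A ∨ ab.2 ∈ B)} with hJdef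
  have hJ : J ⊆ A ×ˢ univ ∪ univ ×ˢ B := by
    intro ab hab
    simpa using (Finset.mem_filter.1 hab).2.2
  have hI := Finset.card_union_add_card_inter (A ×ˢ (univ : Finset (Fin n))) (univ ×ˢ B)
  have hinter : A ×ˢ (univ : Finset (Fin n)) ∩ univ ×ˢ B = A ×ˢ B := by
    ext ab; simp
  rw [hinter] at hI
  simp only [Finset.card_product, Finset.card_univ, Fintype.card_fin] at hI
  have hsn : s * n = #A * n + n * #B := by rw [← hs]; ring
  have hsum : relCard r = #J + #O := by
    rw [relCard, ← Finset.card_union_of_disjoint]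
    · congr 1
      ext ab
      simp only [hOdef, hJdef, Finset.mem_union, Finset.mem_filter, Finset.mem_univ, true_and]
      tauto
    · rw [Finset.disjoint_filter]
      tauto
  have hJc := Finset.card_le_card hJ
  refine ⟨by omega, fun heq => ?_⟩
  have hAB : #A * #B = 0 := by omega
  have hJeq : J = A ×ˢ univ ∪ univ ×ˢ B := Finset.eq_of_subset_of_card_le hJ (by omega)
  have hOeq : #O = d := by omega
  have hr : ∀ a b, r a b ↔ a ∈ A ∨ b ∈ B ∨ (a, b) ∈ O := by
    intro a b
    have h1 : (a, b) ∈ J ↔ (a, b) ∈ A ×ˢ univ ∪ univ ×ˢ B := by rw [hJeq]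
    simp only [hJdef, Finset.mem_filter, Finset.mem_univ, true_and, Finset.mem_union,
      Finset.mem_product, and_true] at h1
    simp only [hOdef, Finset.mem_filter, Finset.mem_univ, true_and]
    tauto
  rcases Nat.mul_eq_zero.1 hAB with h0 | h0
  · right
    rw [Finset.card_eq_zero] at h0
    refine ⟨B, O.map (Equiv.prodComm _ _).toEmbedding, by simpa [h0] using hs, by simpa using hOeq,
      ?_, fun b a => ?_⟩
    · intro ab hab
      obtain ⟨⟨a, b⟩, h1, rfl⟩ := Finset.mem_map.1 hab
      exact (Finset.mem_filter.1 h1).2.2.2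
    · change r a b ↔ _
      rw [hr]
      simp [h0]
  · left
    rw [Finset.card_eq_zero] at h0
    refine ⟨A, O, by simpa [h0] using hs, hOeq, ?_, fun a b => ?_⟩
    · exact fun ab hab => (Finset.mem_filter.1 hab).2.2.1
    · rw [hr]
      simp [h0]

/-- The extremal problem for one colour: without a placement of the cycle of length `2t + 2` that
has at least `t` edges in `r`, the graph `r` has at most `s * n + (m - 1)` edges, where `t = 2s + m` and
`m` is `1` or `2`. -/
theorem relCard_le_of_no_cycle {n s t m : ℕ} (ht : t = 2 * s + m) (hm : m = 1 ∨ m = 2)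
    (h : t + 1 ≤ n) (hn : (t - 1) * (t - s) < n) (r : Fin n → Fin n → Prop)
    (hno : ¬ ∃ σ τ, (t : ℤ) ≤ cycleCount h r σ τ) :
    relCard r ≤ s * n + (m - 1) ∧ (relCard r = s * n + (m - 1) →
      IsStarUnion r s (m - 1) ∨ IsStarUnion (fun b a => r a b) s (m - 1)) := by
  classical
  rcases exists_matching_or_cover r t with ⟨x, y, hx, hy, hxy⟩ | ⟨X, Y, hXY, hcov⟩
  · refine absurd (exists_cycleCount_ge (p := 0) (q := 0) (by omega) h r Fin.elim0 Fin.elim0 x y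
      (fun i => i.elim0) (fun i => i.elim0) hx hy (fun i => i.elim0) (fun i => i.elim0)
      (fun i => i.elim0) (fun i => i.elim0) ?_) hno
    calc (t : ℤ) = ∑ i : Fin t, (1 : ℤ) := by simp
      _ ≤ _ := Finset.sum_le_sum fun i _ => by
        rw [ind_of (hxy i)]
        split_ifs with hi
        · have := ind_nonneg r (x ⟨i.val + 1, hi⟩) (y i)
          omega
        · simp
  have hC : #(X.disjSum Y) < t := by rwa [Finset.card_disjSum]
  have hsumle := relCard_le_sum_relDegree r X Y hcov
  by_cases hhigh : #{c ∈ X.disjSum Y | t ≤ relDegree r c} < s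
  · have := relCard_lt_of_few_high r (by omega) hn (by omega) _ hC hsumle hhigh
    exact ⟨by omega, fun _ => by omega⟩
  obtain ⟨S, hSH, hS⟩ := Finset.exists_subset_card_eq (not_lt.1 hhigh)
  have hdeg : ∀ c ∈ S, t ≤ relDegree r c := fun c hc => (Finset.mem_filter.1 (hSH hc)).2
  have hcard : #S.toLeft + #S.toRight = s := by rw [Finset.card_toLeft_add_card_toRight, hS]
  refine relCard_le_of_cover r S.toLeft S.toRight hcard ?_
  by_contra hO
  have hO' := Nat.le_of_pred_lt (not_le.1 hO)
  obtain ⟨x, y, hx, hy, hxA, hyB, hxy⟩ := exists_zigzag r hm S.toLeft S.toRight (by omega)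
    (by omega) _ (fun ab hab => (Finset.mem_filter.1 hab).2) hO'
  let α : Fin #S.toLeft → Fin n := fun j => (S.toLeft.equivFin.symm j).1
  let β : Fin #S.toRight → Fin n := fun j => (S.toRight.equivFin.symm j).1
  have hα : ∀ j, α j ∈ S.toLeft := fun j => (S.toLeft.equivFin.symm j).2
  have hβ : ∀ j, β j ∈ S.toRight := fun j => (S.toRight.equivFin.symm j).2
  refine hno (exists_cycleCount_ge (m := m) (by omega) h r α β x y
    (Subtype.val_injective.comp (Equiv.injective _))
    (Subtype.val_injective.comp (Equiv.injective _)) hx hy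
    (fun i j hij => hxA j (hij ▸ hα i)) (fun i j hij => hyB j (hij ▸ hβ i))
    (fun j => ?_) (fun j => ?_) hxy)
  · have : t ≤ #{b | r (α j) b} := hdeg _ (Finset.mem_toLeft.1 (hα j))
    omega
  · have : t ≤ #{a | r a (β j)} := hdeg _ (Finset.mem_toRight.1 (hβ j))
    omega

/-! ### Colour classes as relations -/

theorem ext_biRel {n : ℕ} {R R' : SimpleGraph (Fin n ⊕ Fin n)} (hR : R ≤ Knn n) (hR' : R' ≤ Knn n)
    (h : ∀ a b, biRel R a b ↔ biRel R' a b) : R = R' := by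
  ext x y
  have aux : ∀ {R : SimpleGraph (Fin n ⊕ Fin n)}, R ≤ Knn n → ∀ {x y}, R.Adj x y →
      x.isLeft ∧ y.isRight ∨ x.isRight ∧ y.isLeft := fun hR _ _ hxy => by simpa using hR hxy
  rcases x with a | b <;> rcases y with a' | b'
  · exact ⟨fun e => by simpa using aux hR e, fun e => by simpa using aux hR' e⟩
  · exact h a b'
  · rw [R.adj_comm, R'.adj_comm]; exact h a' b
  · exact ⟨fun e => by simpa using aux hR e, fun e => by simpa using aux hR' e⟩

theorem ncard_edgeSet_eq_relCard {n : ℕ} {R : SimpleGraph (Fin n ⊕ Fin n)} (hR : R ≤ Knn n) :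
    R.edgeSet.ncard = relCard (biRel R) := by
  classical
  have hinj : Function.Injective fun ab : Fin n × Fin n =>
      s((Sum.inl ab.1 : Fin n ⊕ Fin n), Sum.inr ab.2) := by
    rintro ⟨a, b⟩ ⟨a', b'⟩ h
    simpa [Sym2.eq_iff] using h
  rw [relCard, ← Set.ncard_coe_finset, ← Set.ncard_image_of_injective _ hinj]
  congr 1
  ext e
  induction e with
  | _ x y =>
    constructor
    · intro hxy
      rw [SimpleGraph.mem_edgeSet] at hxy
      have hK := hR hxy
      rcases x with a | b <;> rcases y with a' | b' <;> simp at hK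
      · exact ⟨(a, b'), Finset.mem_coe.2 (Finset.mem_filter.2 ⟨Finset.mem_univ _, hxy⟩), rfl⟩
      · exact ⟨(a', b), Finset.mem_coe.2 (Finset.mem_filter.2 ⟨Finset.mem_univ _, hxy.symm⟩),
          Sym2.eq_swap⟩
    · rintro ⟨⟨a, b⟩, hab, he⟩
      rw [← he, SimpleGraph.mem_edgeSet]
      exact (Finset.mem_filter.1 (Finset.mem_coe.1 hab)).2

theorem IsTwoColoring.ncard_add_ncard {n : ℕ} {R B : SimpleGraph (Fin n ⊕ Fin n)}
    (h : IsTwoColoring n R B) : R.edgeSet.ncard + B.edgeSet.ncard = n * n := by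
  rw [← Set.ncard_union_eq (SimpleGraph.disjoint_edgeSet.2 h.1), ← SimpleGraph.edgeSet_sup, h.2,
    ncard_edgeSet_eq_relCard le_rfl]
  simp [relCard, biRel]

theorem IsStarUnion.relCard_eq {n s d : ℕ} {r : Fin n → Fin n → Prop} (h : IsStarUnion r s d) :
    relCard r = s * n + d := by
  classical
  obtain ⟨A, O, hA, hO, hdisj, hr⟩ := h
  have : ({ab : Fin n × Fin n | r ab.1 ab.2} : Finset _) = A ×ˢ univ ∪ O := by
    ext ab
    simp [hr]
  rw [relCard, this, Finset.card_union_of_disjoint, hO, Finset.card_product, hA]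
  · simp
  · rw [Finset.disjoint_left]
    intro ab hab hO
    exact hdisj ab hO (Finset.mem_product.1 hab).1

theorem exists_isStarUnion {n s d : ℕ} (hs : s < n) (hd : d ≤ 1) :
    ∃ r : Fin n → Fin n → Prop, IsStarUnion r s d := by
  classical
  let A : Finset (Fin n) := {a | a.val < s}
  have hA : #A = s := by
    have : A = Finset.Iio ⟨s, hs⟩ := by ext a; simp [A, Fin.lt_def]
    rw [this, Fin.card_Iio]
  have hdO : d ≤ #({(⟨s, hs⟩, ⟨s, hs⟩)} : Finset (Fin n × Fin n)) := by simpa using hd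
  obtain ⟨O, hO, hOd⟩ := Finset.exists_subset_card_eq hdO
  refine ⟨fun a b => a ∈ A ∨ (a, b) ∈ O, A, O, hA, hOd, fun ab hab => ?_, fun _ _ => Iff.rfl⟩
  rw [Finset.mem_singleton.1 (hO hab)]
  simp [A]

/-! ### Isomorphism up to isolated vertices -/

/-- Deleting isolated vertices makes a graph isomorphic to its image under an injection. -/
theorem edgeIso_map {V W : Type} (H : SimpleGraph W) (φ : W ↪ V) : EdgeIso (H.map φ) H := by
  have hs : ∀ w, φ w ∈ (H.map φ).support ↔ w ∈ H.support := fun w => by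
    simp [SimpleGraph.support_map]
  let e : H.support ≃ (H.map φ).support :=
    Equiv.ofBijective (fun w => ⟨φ w.1, (hs _).2 w.2⟩) ⟨fun u v huv => by
      simpa [Subtype.ext_iff] using huv, fun ⟨x, hx⟩ => by
      have hx' := hx
      rw [SimpleGraph.support_map] at hx'
      obtain ⟨w, hw, rfl⟩ := hx'
      exact ⟨⟨w, hw⟩, rfl⟩⟩
  exact ⟨(⟨e, by
    intro u v
    change (H.map φ).Adj (φ u.1) (φ v.1) ↔ H.Adj u.1 v.1
    simp⟩ : H.induce H.support ≃g (H.map φ).induce (H.map φ).support).symm⟩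

/-- In a graph in which all edges but possibly one meet a set of `s` vertices, a path has at most
`2s` edges, and one more if there is that exceptional edge. -/
theorem colorCount_le_of_edgeIso {n k s d : ℕ} {W : Type} (H : SimpleGraph W) (C : Finset W)
    (hC : #C ≤ s) (e₀ : Sym2 W)
    (hcov : ∀ u v, H.Adj u v → u ∉ C → v ∉ C → 1 ≤ d ∧ s(u, v) = e₀)
    {R : SimpleGraph (Fin n ⊕ Fin n)} (hRH : EdgeIso R H) (f : (P k).Copy (Knn n)) :
    colorCount (P k) f R ≤ 2 * s + d := by
  classical
  obtain ⟨e⟩ := hRH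
  have hf : Function.Injective f := f.injective'
  let C' : Finset (Fin n ⊕ Fin n) := {v | ∃ h : v ∈ R.support, (e ⟨v, h⟩).1 ∈ C}
  have hC' : #C' ≤ s := by
    refine le_trans (Finset.card_le_card_of_forall_subsingleton
      (fun v w => ∃ h : v ∈ R.support, (e ⟨v, h⟩).1 = w) (fun v hv => ?_) fun w _ => ?_) hC
    · obtain ⟨h, hw⟩ := (Finset.mem_filter.1 hv).2
      exact ⟨_, hw, h, rfl⟩
    · rintro v ⟨_, h, hv⟩ v' ⟨_, h', hv'⟩
      have := e.injective (Subtype.ext (hv.trans hv'.symm))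
      exact congrArg Subtype.val this
  have hinC : ∀ g : Fin k → Fin n ⊕ Fin n, Function.Injective g → #{i : Fin k | g i ∈ C'} ≤ s :=
    fun g hg => le_trans (Finset.card_le_card_of_injOn g (fun i hi => by simpa using hi)
      hg.injOn) hC'
  have h1 := hinC (fun i => f i.castSucc) (hf.comp (Fin.castSucc_injective k))
  have h2 := hinC (fun i => f i.succ) (hf.comp (Fin.succ_injective k))
  -- the path edges which avoid `C'` are all sent to `e₀`
  have h3 : #{i : Fin k | R.Adj (f i.castSucc) (f i.succ) ∧ f i.castSucc ∉ C' ∧ f i.succ ∉ C'} ≤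
      d := by
    have key : ∀ i : Fin k, (R.Adj (f i.castSucc) (f i.succ) ∧ f i.castSucc ∉ C' ∧
        f i.succ ∉ C') → 1 ≤ d ∧ ∃ (hu : f i.castSucc ∈ R.support) (hv : f i.succ ∈ R.support),
          s((e ⟨_, hu⟩).1, (e ⟨_, hv⟩).1) = e₀ := by
      rintro i ⟨hR, hu, hv⟩
      have hsu : f i.castSucc ∈ R.support := ⟨_, hR⟩
      have hsv : f i.succ ∈ R.support := ⟨_, hR.symm⟩
      have hH : H.Adj (e ⟨_, hsu⟩).1 (e ⟨_, hsv⟩).1 :=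
        e.map_rel_iff.2 (show (R.induce R.support).Adj ⟨_, hsu⟩ ⟨_, hsv⟩ from hR)
      have := hcov _ _ hH (fun h => hu (by simp only [C', Finset.mem_filter]; exact ⟨by simp, _, h⟩))
        (fun h => hv (by simp only [C', Finset.mem_filter]; exact ⟨by simp, _, h⟩))
      exact ⟨this.1, hsu, hsv, this.2⟩
    by_cases hd : 1 ≤ d
    · refine le_trans (Finset.card_le_one.2 fun i hi j hj => ?_) hd
      obtain ⟨_, hu, hv, hi'⟩ := key i (Finset.mem_filter.1 hi).2
      obtain ⟨_, hu', hv', hj'⟩ := key j (Finset.mem_filter.1 hj).2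
      have he : Function.Injective fun x : R.support => (e x).1 :=
        Subtype.val_injective.comp e.injective
      have e1 : s((⟨_, hu⟩ : R.support), ⟨_, hv⟩) = s(⟨_, hu'⟩, ⟨_, hv'⟩) :=
        Sym2.map.injective he (hi'.trans hj'.symm)
      have e2 := congrArg (Sym2.map Subtype.val) e1
      exact pathEdge_injective k (Sym2.map.injective hf e2)
    · rw [Finset.card_eq_zero.2 (Finset.filter_eq_empty_iff.2 fun i _ hi => hd (key i hi).1)]
      exact Nat.zero_le _
  rw [colorCount_P]
  set S₁ : Finset (Fin k) := {i | f i.castSucc ∈ C'} with hS₁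
  set S₂ : Finset (Fin k) := {i | f i.succ ∈ C'} with hS₂
  set S₃ : Finset (Fin k) :=
    {i | R.Adj (f i.castSucc) (f i.succ) ∧ f i.castSucc ∉ C' ∧ f i.succ ∉ C'} with hS₃
  have hsub : ({i | R.Adj (f i.castSucc) (f i.succ)} : Finset (Fin k)) ⊆ (S₁ ∪ S₂) ∪ S₃ := by
    intro i hi
    have hi' := (Finset.mem_filter.1 hi).2
    simp only [hS₁, hS₂, hS₃, Finset.mem_union, Finset.mem_filter, Finset.mem_univ, true_and]
    tauto
  have a0 := Finset.card_le_card hsub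
  have a1 := Finset.card_union_le (S₁ ∪ S₂) S₃
  have a2 := Finset.card_union_le S₁ S₂
  omega

/-! ### The balancing number and the extremal family -/

/-- For `d ≤ 1`, the graph `H` is up to isolated vertices the only graph formed by `s` full stars
and `d` further edges: every relation of that form is the image of `H` under an injection of the
vertices, and all edges of `H`, except for the edge `e₀` if `d = 1`, meet a set of `s` vertices. -/
structure IsStarModel {W : Type} (n s d : ℕ) (H : SimpleGraph W) : Prop where
  embed : ∀ r : Fin n → Fin n → Prop, IsStarUnion r s d → ∃ φ : W ↪ Fin n ⊕ Fin n,
    H.map φ ≤ Knn n ∧ ∀ a b, biRel (H.map φ) a b ↔ r a b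
  cover : ∃ (C : Finset W) (e₀ : Sym2 W), #C ≤ s ∧
    ∀ u v, H.Adj u v → u ∉ C → v ∉ C → 1 ≤ d ∧ s(u, v) = e₀

theorem IsStarModel.edgeIso {W : Type} {n s d : ℕ} {H : SimpleGraph W} (hH : IsStarModel n s d H)
    {R : SimpleGraph (Fin n ⊕ Fin n)} (hR : R ≤ Knn n)
    (h : IsStarUnion (biRel R) s d ∨ IsStarUnion (fun b a => biRel R a b) s d) : EdgeIso R H := by
  rcases h with h | h
  · obtain ⟨φ, hφ, hr⟩ := hH.embed _ h
    rw [← ext_biRel hφ hR hr]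
    exact edgeIso_map H φ
  · obtain ⟨φ, hφ, hr⟩ := hH.embed _ h
    let θ : Fin n ⊕ Fin n ↪ Fin n ⊕ Fin n := (Equiv.sumComm (Fin n) (Fin n)).toEmbedding
    have hmap : (H.map φ).map θ = H.map (φ.trans θ) := SimpleGraph.map_map _ _ _
    have hadj : ∀ x y, ((H.map φ).map θ).Adj (θ x) (θ y) ↔ (H.map φ).Adj x y := fun x y =>
      SimpleGraph.map_adj_apply
    have hle : (H.map φ).map θ ≤ Knn n := by
      rw [SimpleGraph.map_le_iff_le_comap]
      intro x y hxy
      have := hφ hxy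
      rcases x with a | b <;> rcases y with a' | b' <;> simp [θ] at this ⊢
    have : H.map (φ.trans θ) = R := by
      rw [← hmap]
      refine ext_biRel hle hR fun a b => ?_
      have h1 := hadj (Sum.inr a) (Sum.inl b)
      have h2 := hr b a
      rw [← h2]
      exact h1.trans (SimpleGraph.adj_comm _ _ _)
    rw [← this]
    exact edgeIso_map H _

/-- The star graph and its complement in `K_{n,n}` form a colouring. -/
theorem IsStarModel.exists_coloring {W : Type} {n s d : ℕ} {H : SimpleGraph W}
    (hH : IsStarModel n s d H) (hs : s < n) (hd : d ≤ 1) :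
    ∃ R B, IsTwoColoring n R B ∧ EdgeIso R H ∧ R.edgeSet.ncard = s * n + d ∧
      H.edgeSet.encard = R.edgeSet.encard := by
  obtain ⟨r, hr⟩ := exists_isStarUnion hs hd
  obtain ⟨φ, hφ, hφr⟩ := hH.embed r hr
  refine ⟨H.map φ, Knn n \ H.map φ, ⟨disjoint_sdiff_self_right, sup_sdiff_cancel_right hφ⟩,
    edgeIso_map H φ, ?_, ?_⟩
  · have : biRel (H.map φ) = r := by
      funext a b
      exact propext (hφr a b)
    rw [ncard_edgeSet_eq_relCard hφ, this, hr.relCard_eq]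
  · rw [SimpleGraph.edgeSet_map]
    exact (Function.Injective.encard_image (Function.Embedding.injective _) _).symm

theorem IsStarModel.not_hasBalancedCopy {W : Type} {n k s d t : ℕ} {H : SimpleGraph W}
    (hH : IsStarModel n s d H) (ht : t = 2 * s + (d + 1)) (hk : 2 * t ≤ k)
    {R B : SimpleGraph (Fin n ⊕ Fin n)} (hRB : IsTwoColoring n R B) (hR : EdgeIso R H) :
    ¬ HasBalancedCopy (P k) R B := by
  rintro ⟨f, hf⟩
  obtain ⟨C, e₀, hC, hcov⟩ := hH.cover
  have h1 := colorCount_le_of_edgeIso H C hC e₀ hcov hR f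
  have h2 := hRB.colorCount_add f
  rw [abs_le] at hf
  omega

theorem IsTwoColoring.left_le {n : ℕ} {R B : SimpleGraph (Fin n ⊕ Fin n)}
    (h : IsTwoColoring n R B) : R ≤ Knn n := h.2 ▸ le_sup_left

/-- A colouring without a balanced path has a colour class with at most `s * n + d` edges, which
is the star graph in case of equality. -/
theorem IsStarModel.of_not_hasBalancedCopy {W : Type} {n k s d t : ℕ} {H : SimpleGraph W}
    (hH : IsStarModel n s d H) (hd : d ≤ 1) (ht : t = 2 * s + (d + 1)) (h : t + 1 ≤ n)
    (hn : (t - 1) * (t - s) < n) (hk : k = 2 * t ∨ k = 2 * t + 1)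
    {R B : SimpleGraph (Fin n ⊕ Fin n)} (hRB : IsTwoColoring n R B)
    (hno : ¬ HasBalancedCopy (P k) R B) :
    (R.edgeSet.ncard ≤ s * n + d ∧ (R.edgeSet.ncard = s * n + d → EdgeIso R H)) ∨
    (B.edgeSet.ncard ≤ s * n + d ∧ (B.edgeSet.ncard = s * n + d → EdgeIso B H)) := by
  have key : ∀ {R B : SimpleGraph (Fin n ⊕ Fin n)}, IsTwoColoring n R B →
      (¬ ∃ σ τ, (t : ℤ) ≤ cycleCount h (biRel R) σ τ) →
      R.edgeSet.ncard ≤ s * n + d ∧ (R.edgeSet.ncard = s * n + d → EdgeIso R H) := by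
    intro R B hRB hR
    have := relCard_le_of_no_cycle (m := d + 1) ht (by omega) h hn _ hR
    rw [ncard_edgeSet_eq_relCard hRB.left_le]
    exact ⟨this.1, fun he => hH.edgeIso hRB.left_le (this.2 he)⟩
  by_cases hR : ∃ σ τ, (t : ℤ) ≤ cycleCount h (biRel R) σ τ
  · by_cases hB : ∃ σ τ, (t : ℤ) ≤ cycleCount h (biRel B) σ τ
    · exact absurd (hRB.hasBalancedCopy (by omega) h hk hR hB) hno
    · exact Or.inr (key hRB.symm hB)
  · exact Or.inl (key hRB hR)

theorem IsStarModel.bbal_eq_and_isBbal {W : Type} {n k s d t : ℕ} {H : SimpleGraph W}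
    (hH : IsStarModel n s d H) (hd : d ≤ 1) (ht : t = 2 * s + (d + 1)) (h : t + 1 ≤ n)
    (hn : (t - 1) * (t - s) < n) (hk : k = 2 * t ∨ k = 2 * t + 1) :
    bbal n (P k) = s * n + d ∧ IsBbal n (P k) {⟨W, H⟩} := by
  obtain ⟨R₀, B₀, hcol, hiso, hcard, hencard⟩ := hH.exists_coloring (by omega) hd
  have hno₀ : ¬ HasBalancedCopy (P k) R₀ B₀ := hH.not_hasBalancedCopy ht (by omega) hcol hiso
  -- the colour classes cannot both have at most `s * n + d` edges
  have hhalf : 2 * (s * n + d) < n * n := by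
    have : (2 * s + d + 2) * n ≤ n * n := Nat.mul_le_mul_right n (by omega)
    nlinarith
  have hbbal : bbal n (P k) = s * n + d := by
    refine le_antisymm (Nat.sInf_le fun R B hRB hR hB => ?_)
      (le_csInf (exists_forcesBalanced n (P k)) fun m hm => ?_)
    · by_contra hno
      rcases hH.of_not_hasBalancedCopy hd ht h hn hk hRB hno with h' | h'
      · exact absurd h'.1 (not_le.2 hR)
      · exact absurd h'.1 (not_le.2 hB)
    · by_contra hlt
      have := hcol.ncard_add_ncard
      exact hno₀ (hm R₀ B₀ hcol (by omega) (by omega))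
  have main : ∀ R B : SimpleGraph (Fin n ⊕ Fin n), IsTwoColoring n R B →
      R.edgeSet.ncard = s * n + d → ¬ HasBalancedCopy (P k) R B → EdgeIso R H := by
    intro R B hRB hR hno
    have := hRB.ncard_add_ncard
    rcases hH.of_not_hasBalancedCopy hd ht h hn hk hRB hno with h' | h'
    · exact h'.2 hR
    · omega
  refine ⟨hbbal, ?_, ?_, ?_⟩
  · rintro _ rfl
    rw [hbbal, hencard, ← hcard, Set.Finite.cast_ncard_eq (Set.toFinite _)]
  · intro R B hRB hor
    rw [hbbal] at hor
    constructor
    · intro hno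
      refine ⟨_, rfl, ?_⟩
      rcases hor with h' | h'
      · exact Or.inl (main R B hRB h' hno)
      · exact Or.inr (main B R hRB.symm h' fun hb => hno hb.symm)
    · rintro ⟨_, rfl, hR | hB⟩
      · exact hH.not_hasBalancedCopy ht (by omega) hRB hR
      · exact fun hb => hH.not_hasBalancedCopy ht (by omega) hRB.symm hB hb.symm
  · rintro _ rfl
    exact ⟨R₀, B₀, hcol, hno₀, hiso⟩

/-! ### The graphs `K_{s,n}` and `H_{s,n}` -/

theorem map_sumMap_le {α β : Type} {n : ℕ} {H : SimpleGraph (α ⊕ β)}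
    (hH : H ≤ completeBipartiteGraph α β) (f : α ↪ Fin n) (g : β ↪ Fin n) :
    H.map (f.sumMap g) ≤ Knn n := by
  rw [SimpleGraph.map_le_iff_le_comap]
  intro x y hxy
  have := hH hxy
  rcases x with a | b <;> rcases y with a' | b' <;> simp at this ⊢

theorem biRel_map_sumMap {α β : Type} {n : ℕ} (H : SimpleGraph (α ⊕ β)) (f : α ↪ Fin n)
    (g : β ↪ Fin n) (a b : Fin n) : biRel (H.map (f.sumMap g)) a b ↔
      ∃ x y, f x = a ∧ g y = b ∧ H.Adj (Sum.inl x) (Sum.inr y) := by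
  rw [biRel, SimpleGraph.map_adj]
  constructor
  · rintro ⟨u, v, huv, hu, hv⟩
    rcases u with x | x <;> rcases v with y | y <;> simp at hu hv
    exact ⟨x, y, hu, hv, huv⟩
  · rintro ⟨x, y, rfl, rfl, hxy⟩
    exact ⟨_, _, hxy, rfl, rfl⟩

theorem isStarModel_completeBipartiteGraph (n s : ℕ) (hn : 0 < n) :
    IsStarModel n s 0 (completeBipartiteGraph (Fin s) (Fin n)) where
  embed := by
    rintro r ⟨A, O, hA, hO, -, hr⟩
    rw [Finset.card_eq_zero] at hO
    let e := A.equivFinOfCardEq hA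
    refine ⟨(e.symm.toEmbedding.trans (Function.Embedding.subtype _)).sumMap
      (Function.Embedding.refl _), map_sumMap_le le_rfl _ _, fun a b => ?_⟩
    rw [biRel_map_sumMap, hr, hO]
    constructor
    · rintro ⟨x, y, rfl, rfl, -⟩
      exact Or.inl (e.symm x).2
    · rintro (h | h)
      · exact ⟨e ⟨a, h⟩, b, by simp, rfl, by simp⟩
      · simp at h
  cover := by
    refine ⟨univ.map Function.Embedding.inl, s(Sum.inr ⟨0, hn⟩, Sum.inr ⟨0, hn⟩), by simp, ?_⟩
    rintro (i | j) (i' | j') h hu hv <;> simp at h hu hv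

theorem pendantKsn_adj {s n : ℕ} (o : Option (Fin s)) (j : Fin n) :
    (pendantKsn s n).Adj (Sum.inl o) (Sum.inr j) ↔ o ≠ none ∨ j.val = 0 := by
  cases o <;> simp [pendantKsn]

theorem pendantKsn_le (s n : ℕ) :
    pendantKsn s n ≤ completeBipartiteGraph (Option (Fin s)) (Fin n) := by
  rintro (o | j) (o' | j') h
  · cases o <;> cases o' <;> simp [pendantKsn] at h
  · simp
  · simp
  · simp [pendantKsn] at h

theorem isStarModel_pendantKsn (n s : ℕ) (hn : 0 < n) : IsStarModel n s 1 (pendantKsn s n) where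
  embed := by
    classical
    rintro r ⟨A, O, hA, hO, hOA, hr⟩
    obtain ⟨⟨a₀, b₀⟩, rfl⟩ := Finset.card_eq_one.1 hO
    have ha₀ : a₀ ∉ A := hOA _ (Finset.mem_singleton_self _)
    let e := A.equivFinOfCardEq hA
    let f : Option (Fin s) ↪ Fin n := Function.Embedding.optionElim
      (e.symm.toEmbedding.trans (Function.Embedding.subtype _)) a₀ (by
        rintro ⟨x, hx⟩
        exact ha₀ (hx ▸ (e.symm x).2))
    let g : Fin n ↪ Fin n := (Equiv.swap ⟨0, hn⟩ b₀).toEmbedding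
    have hf : f none = a₀ := rfl
    have hfs : ∀ x, f (some x) = (e.symm x).1 := fun _ => rfl
    have hg : ∀ y, g y = Equiv.swap ⟨0, hn⟩ b₀ y := fun _ => rfl
    refine ⟨f.sumMap g, map_sumMap_le (pendantKsn_le s n) _ _, fun a b => ?_⟩
    rw [biRel_map_sumMap, hr]
    constructor
    · rintro ⟨x, y, rfl, rfl, hxy⟩
      rw [pendantKsn_adj] at hxy
      cases x with
      | none =>
        right
        have hy : y = ⟨0, hn⟩ := Fin.ext (by simpa using hxy)
        rw [hf, hy, hg, Equiv.swap_apply_left]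
        exact Finset.mem_singleton_self _
      | some x => exact Or.inl (hfs x ▸ (e.symm x).2)
    · rintro (h | h)
      · refine ⟨some (e ⟨a, h⟩), Equiv.swap ⟨0, hn⟩ b₀ b, ?_, ?_, ?_⟩
        · rw [hfs]; simp
        · rw [hg, Equiv.swap_apply_self]
        · rw [pendantKsn_adj]; simp
      · obtain ⟨rfl, rfl⟩ := Prod.mk.inj (Finset.mem_singleton.1 h)
        exact ⟨none, ⟨0, hn⟩, hf, by rw [hg, Equiv.swap_apply_left], by rw [pendantKsn_adj]; simp⟩
  cover := by
    have aux : ∀ o (j : Fin n), (pendantKsn s n).Adj (Sum.inl o) (Sum.inr j) →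
        (Sum.inl o : Option (Fin s) ⊕ Fin n) ∉ univ.map
          (Function.Embedding.some.trans Function.Embedding.inl) →
        o = none ∧ j = ⟨0, hn⟩ := by
      intro o j h ho
      have ho' : o = none := by
        cases o with
        | none => rfl
        | some x => exact absurd (Finset.mem_map.2 ⟨x, Finset.mem_univ _, rfl⟩) ho
      subst ho'
      rw [pendantKsn_adj] at h
      exact ⟨rfl, Fin.ext (by simpa using h)⟩
    refine ⟨univ.map (Function.Embedding.some.trans Function.Embedding.inl),
      s(Sum.inl none, Sum.inr ⟨0, hn⟩), by simp, fun u v h hu hv => ⟨le_rfl, ?_⟩⟩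
    have hb := pendantKsn_le s n h
    rcases u with o | j <;> rcases v with o' | j'
    · simp at hb
    · obtain ⟨rfl, rfl⟩ := aux o j' h hu
      rfl
    · obtain ⟨rfl, rfl⟩ := aux o' j h.symm hv
      exact Sym2.eq_swap
    · simp at hb

end BipartiteBalancing

theorem theorem4p2 (n k : ℕ) (hn : 2 ≤ n) (hk : 2 ≤ k) (hk_even : Even k)
    (hnk : (k - 2) / 2 * (k / 2 - (k - 2) / 4) < n) :
    BipartiteBalancing.bbal n (BipartiteBalancing.P k) = (k - 2) / 4 * n + 0 ^ (k % 4) ∧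
    BipartiteBalancing.bbal n (BipartiteBalancing.P (k + 1)) = (k - 2) / 4 * n + 0 ^ (k % 4) ∧
    (k % 4 = 2 →
      BipartiteBalancing.IsBbal n (BipartiteBalancing.P k)
        {⟨_, completeBipartiteGraph (Fin ((k - 2) / 4)) (Fin n)⟩} ∧
      BipartiteBalancing.IsBbal n (BipartiteBalancing.P (k + 1))
        {⟨_, completeBipartiteGraph (Fin ((k - 2) / 4)) (Fin n)⟩}) ∧
    (k % 4 = 0 →
      BipartiteBalancing.IsBbal n (BipartiteBalancing.P k)
        {⟨_, BipartiteBalancing.pendantKsn ((k - 2) / 4) n⟩} ∧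
      BipartiteBalancing.IsBbal n (BipartiteBalancing.P (k + 1))
        {⟨_, BipartiteBalancing.pendantKsn ((k - 2) / 4) n⟩}) := by
  obtain ⟨t, rfl⟩ := hk_even
  have hn' : (t - 1) * (t - (t + t - 2) / 4) < n := by
    have e1 : (t + t - 2) / 2 = t - 1 := by omega
    have e2 : (t + t) / 2 = t := by omega
    rwa [e1, e2] at hnk
  have h : t + 1 ≤ n := by
    rcases Nat.lt_or_ge t 2 with ht | ht
    · omega
    · have : (t - 1) * 2 ≤ (t - 1) * (t - (t + t - 2) / 4) := Nat.mul_le_mul_left _ (by omega)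
      omega
  have main : ∀ {W : Type} {H : SimpleGraph W} {d : ℕ},
      BipartiteBalancing.IsStarModel n ((t + t - 2) / 4) d H → d ≤ 1 →
      t = 2 * ((t + t - 2) / 4) + (d + 1) → ∀ k, k = 2 * t ∨ k = 2 * t + 1 →
      BipartiteBalancing.bbal n (BipartiteBalancing.P k) = (t + t - 2) / 4 * n + d ∧
        BipartiteBalancing.IsBbal n (BipartiteBalancing.P k) {⟨W, H⟩} :=
    fun hH hd ht k hk => hH.bbal_eq_and_isBbal hd ht h hn' hk
  obtain hmod | hmod : (t + t) % 4 = 2 ∨ (t + t) % 4 = 0 := by omega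
  · have hH := BipartiteBalancing.isStarModel_completeBipartiteGraph n ((t + t - 2) / 4) (by omega)
    have h0 := main hH (by omega) (by omega) (t + t) (by omega)
    have h1 := main hH (by omega) (by omega) (t + t + 1) (by omega)
    rw [hmod]
    exact ⟨h0.1, h1.1, fun _ => ⟨h0.2, h1.2⟩, fun hne => absurd hne (by omega)⟩
  · have hH := BipartiteBalancing.isStarModel_pendantKsn n ((t + t - 2) / 4) (by omega)
    have h0 := main hH (by omega) (by omega) (t + t) (by omega)
    have h1 := main hH (by omega) (by omega) (t + t + 1) (by omega)
    rw [hmod]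
    exact ⟨h0.1, h1.1, fun hne => absurd hne (by omega), fun _ => ⟨h0.2, h1.2⟩⟩
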